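/- **Carnap–Gödel Diagonal Lemma for £.** *Language.* Terms and formulas are generated simultaneously: the alethizor $\mathrm T$, the enumerator € and the noemata $v_0,v_1,\dots$ are terms; if $a,b$ are terms and $A,B$ formulas, then $\downarrow\! ab$ and $\{v_n\mid A\}$ are terms and $a\in b$ (officially the string $ba$), $\downarrow\! AB$ and $\forall v_nA$ are formulas. Every formula counts as a sentence. A noema is *present* in an expression if it has an occurrence there not bound by $\forall$ or $\{\cdot\mid\cdot\}$; $A(a/u)$ is the result of replacing these occurrences of the noema $u$ in $A$ by the term $a$, and $F(a,u,A)$ says that $a$ is substitutable for $u$ in $A$ (no noema of $a$ gets bound). Put $\neg A:=\downarrow\! AA$, $A\vee B:=\downarrow\downarrow\! AB\downarrow\! AB$, $A\wedge B:=\downarrow\downarrow\! AA\downarrow\! BB$, $A\to B:=\neg A\vee B$, $A\leftrightarrow B:=(A\to B)\wedge(B\to A)$, $\exists yA:=\neg\forall y\neg A$, $a=b:=\forall u(a\in u\to b\in u)$ with $u$ the first noema not present in $a,b$, and $\mathbb TA:=\exists y(y\in\{y\mid A\})$ with $y$ the first noema not present in $A$. Ordered pairs $\langle a,b\rangle$ are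 Kuratowski pairs, formed with $\{a,b\}:=\{x\mid x=a\vee x=b\}$. *Coding.* Write expressions as Polish strings, the symbols $\{\cdot\mid\cdot\}$, $\forall$, $\downarrow$, $\mathrm T$, €, $v_n$ being a bar followed by $0,1,2,3,4,n+5$ dots respectively; reading bar as the binary digit $1$ and dot as $0$ turns each expression into a natural number. The numerals of £ are $\ulcorner 0\urcorner:=\{v_0\mid\neg\forall v_1(v_0\in v_1\to v_0\in v_1)\}$ and $\ulcorner n+1\urcorner:=\{v_0\mid v_0\in\ulcorner n\urcorner\vee\forall v_1(v_0\in v_1\to\ulcorner n\urcorner\in v_1)\}$, and $\ulcorner B\urcorner$ is the numeral of the number of $B$. *Semantics.* Let $\vDash$ be a relation between ordinals and formulas such that for all $\alpha$, all terms $a,b,c,w$, noemata $u,y$ and formulas $A,B$: 1. $\alpha\vDash a\in\{u\mid A\}$ iff $F(a,u,A)$ and for some $\beta<\alpha$, $\gamma\vDash A(a/u)$ whenever $\beta\le\gamma<\alpha$; 2. $\alpha\vDash\,\downarrow\! AB$ iff $\alpha\nvDash A$ and $\alpha\nvDash B$; 3. $\alpha\vDash a\in\,\downarrow\! bc$ iff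 $\alpha\nvDash a\in b$ and $\alpha\nvDash a\in c$; 4. $\alpha\vDash\forall yA$ iff $\alpha\vDash A(a/y)$ for all terms $a$ with $F(a,y,A)$; 5. $\alpha\vDash w\in\mathrm T$ iff $\alpha\vDash w=\ulcorner A\urcorner\wedge\mathbb TA$ for some formula $A$; 6. $\alpha\vDash w\in$ € iff $\alpha\vDash w=\langle\ulcorner n\urcorner,a\rangle\wedge a=v_n$ for some term $a$ and natural number $n$. No condition is imposed on atomic formulas $a\in v_n$. Let $\vDash_\gamma=\{A:\gamma\vDash\mathbb TA\}$, and let $IN$ ($OUT$) be the set of formulas that belong (do not belong) to $\vDash_\gamma$ for all sufficiently large $\gamma$. A limit ordinal $\sigma$ *covers* $\vDash$ if for all $\gamma\ge\sigma$, $IN\subseteq\,\vDash_\gamma$ and $\vDash_\gamma\cap\, OUT=\emptyset$; it *stabilizes* $\vDash$ if moreover $\vDash_\sigma\,\subseteq IN$. The closure ordinal Ϙ is the least stabilizing ordinal. A formula $A$ is a *maxim* if Ϙ $\vDash\mathbb TA$. **Theorem.** For every such $\vDash$, every noema $x$ and every formula $A(x)$ in which $x$ and no other noema is present, there is a sentence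 $B$ such that $B\leftrightarrow A(\ulcorner B\urcorner)$ is a maxim, where $A(\ulcorner B\urcorner)$ is $A(\ulcorner B\urcorner/x)$. -/

import Mathlib

namespace Libra

/-! ## The language

Expressions are given by their formation trees.  The noema `v n` is the symbol consisting of a bar
followed by `n + 5` dots. -/

mutual

/-- Terms: the alethizor `T`, the enumerator `E`, the noemata `v n`, the junctures `↓ab`, and the
abstracts `{v y | A}`. -/
inductive Term : Type
  | T : Term
  | E : Term
  | v : ℕ → Term
  | nor : Term → Term → Term
  | abs : ℕ → Formula → Term

/-- Formulas: `app b a` is the atomic formula `ba` (read `a ∈ b`), `nor A B` is `↓AB`, and `all y A`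
is `∀ v y, A`. -/
inductive Formula : Type
  | app : Term → Term → Formula
  | nor : Formula → Formula → Formula
  | all : ℕ → Formula → Formula

end

mutual

/-- The (indices of the) noemata present in a term. -/
def Term.nun : Term → Finset ℕ
  | .T => ∅
  | .E => ∅
  | .v n => {n}
  | .nor a b => a.nun ∪ b.nun
  | .abs y A => A.nun \ {y}

/-- The (indices of the) noemata present in a formula. -/
def Formula.nun : Formula → Finset ℕ
  | .app b a => b.nun ∪ a.nun
  | .nor A B => A.nun ∪ B.nun
  | .all y A => A.nun \ {y}

end

mutual

/-- `b.subst a u` is `b(a/u)`, the result of putting the term `a` for the noema `v u` in `b`. -/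
def Term.subst (a : Term) (u : ℕ) : Term → Term
  | .T => .T
  | .E => .E
  | .v n => if u = n then a else .v n
  | .nor b c => .nor (Term.subst a u b) (Term.subst a u c)
  | .abs y A => if u = y then .abs y A else .abs y (Formula.subst a u A)

/-- `Formula.subst a u A` is `A(a/u)`, the result of putting the term `a` for the noema `v u`
in `A`. -/
def Formula.subst (a : Term) (u : ℕ) : Formula → Formula
  | .app b c => .app (Term.subst a u b) (Term.subst a u c)
  | .nor A B => .nor (Formula.subst a u A) (Formula.subst a u B)
  | .all y A => if u = y then .all y A else .all y (Formula.subst a u A)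

end

mutual

/-- `Term.FreeFor a u b`: the term `a` is substitutable for the noema `v u` in the term `b`. -/
def Term.FreeFor (a : Term) (u : ℕ) : Term → Prop
  | .T => True
  | .E => True
  | .v _ => True
  | .nor b c => Term.FreeFor a u b ∧ Term.FreeFor a u c
  | .abs y A => u ∉ A.nun \ {y} ∨ (y ∉ a.nun ∧ Formula.FreeFor a u A)

/-- `Formula.FreeFor a u A`: the term `a` is substitutable for the noema `v u` in the
formula `A`. -/
def Formula.FreeFor (a : Term) (u : ℕ) : Formula → Prop
  | .app b c => Term.FreeFor a u b ∧ Term.FreeFor a u c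
  | .nor A B => Formula.FreeFor a u A ∧ Formula.FreeFor a u B
  | .all y A => u ∉ A.nun \ {y} ∨ (y ∉ a.nun ∧ Formula.FreeFor a u A)

end

/-! ## Defined notions of the language -/

/-- The least noema (index) outside a finite set. -/
noncomputable def fresh (s : Finset ℕ) : ℕ := sInf {n | n ∉ s}

namespace Formula

/-- `a ∈ b`, that is, the atomic formula `ba`. -/
def mem (a b : Term) : Formula := .app b a

/-- `¬A := ↓AA`. -/
def neg (A : Formula) : Formula := .nor A A

/-- `A ∨ B := ↓↓AB↓AB`. -/
def or (A B : Formula) : Formula := .nor (.nor A B) (.nor A B)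

/-- `A ∧ B := ↓↓AA↓BB`. -/
def and (A B : Formula) : Formula := .nor (.nor A A) (.nor B B)

/-- `A → B := ↓↓↓AAB↓↓AAB`. -/
def imp (A B : Formula) : Formula := .nor (.nor (.nor A A) B) (.nor (.nor A A) B)

/-- `A ↔ B := (A → B) ∧ (B → A)`. -/
def iff (A B : Formula) : Formula := and (imp A B) (imp B A)

/-- `∃ y A := ¬∀ y ¬A`. -/
def ex (y : ℕ) (A : Formula) : Formula := neg (.all y (neg A))

/-- Leibnizian identity: `a = b := ∀ u (a ∈ u → b ∈ u)`, `u` the first noema not present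
in `a`, `b`. -/
noncomputable def eq (a b : Term) : Formula :=
  let u := fresh (a.nun ∪ b.nun)
  .all u (imp (mem a (.v u)) (mem b (.v u)))

/-- The truth operator `𝕋A := ∃ y (y ∈ {y | A})`, `y` the first noema not present in `A`. -/
noncomputable def tr (A : Formula) : Formula :=
  let y := fresh A.nun
  ex y (mem (.v y) (.abs y A))

end Formula

namespace Term

/-- The unordered pair `{a, b} := {x | x = a ∨ x = b}`. -/
noncomputable def upair (a b : Term) : Term :=
  let x := fresh (a.nun ∪ b.nun)
  .abs x (Formula.or (Formula.eq (.v x) a) (Formula.eq (.v x) b))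

/-- The Kuratowski pair `⟨a, b⟩ := {{a}, {a, b}}`. -/
noncomputable def pair (a b : Term) : Term := upair (upair a a) (upair a b)

/-- The numerals: `⌜0⌝ := {v₀ | ¬∀ v₁ (v₀ ∈ v₁ → v₀ ∈ v₁)}` and
`⌜n+1⌝ := {v₀ | v₀ ∈ ⌜n⌝ ∨ ∀ v₁ (v₀ ∈ v₁ → ⌜n⌝ ∈ v₁)}`. -/
def numeral : ℕ → Term
  | 0 => .abs 0 (Formula.neg
      (.all 1 (Formula.imp (Formula.mem (.v 0) (.v 1)) (Formula.mem (.v 0) (.v 1)))))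
  | n + 1 => .abs 0 (Formula.or (Formula.mem (.v 0) (numeral n))
      (.all 1 (Formula.imp (Formula.mem (.v 0) (.v 1)) (Formula.mem (numeral n) (.v 1)))))

end Term

/-! ## Expressions as natural numbers

The austere Polish string of an expression, with bar read as the binary digit `1` and dot as `0`;
the symbol with `n` dots is `2 ^ n`, and juxtaposition is concatenation of binary numerals. -/

/-- Concatenation of binary numerals, `m * 2 ^ l(n) + n` with `l(n)` the binary length of `n`. -/
def cat (m n : ℕ) : ℕ := m * 2 ^ Nat.size n + n

mutual

/-- The natural number of a term. -/
def Term.code : Term → ℕ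
  | .T => 2 ^ 3
  | .E => 2 ^ 4
  | .v n => 2 ^ (n + 5)
  | .nor a b => cat (2 ^ 2) (cat a.code b.code)
  | .abs y A => cat (2 ^ 0) (cat (2 ^ (y + 5)) A.code)

/-- The natural number of a formula. -/
def Formula.code : Formula → ℕ
  | .app b a => cat b.code a.code
  | .nor A B => cat (2 ^ 2) (cat A.code B.code)
  | .all y A => cat (2 ^ 1) (cat (2 ^ (y + 5)) A.code)

end

/-- `⌜A⌝`: the numeral of the natural number of the formula `A`. -/
def Formula.quote (A : Formula) : Term := Term.numeral A.code

/-! ## The semantics -/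

/-- `S` is a semantic sequence for the language: `A ∈ S α` is read `α ⊨ A`.  The clauses do not
determine when `a ∈ v n` holds for a noema `v n`; every such choice is admitted. -/
structure IsSemantics (S : Ordinal.{0} → Set Formula) : Prop where
  mem_abs : ∀ (α : Ordinal.{0}) (a : Term) (u : ℕ) (A : Formula),
    Formula.mem a (.abs u A) ∈ S α ↔
      Formula.FreeFor a u A ∧ ∃ β < α, ∀ γ, β ≤ γ → γ < α → Formula.subst a u A ∈ S γ
  nor : ∀ (α : Ordinal.{0}) (A B : Formula), Formula.nor A B ∈ S α ↔ A ∉ S α ∧ B ∉ S α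
  mem_nor : ∀ (α : Ordinal.{0}) (a b c : Term),
    Formula.mem a (.nor b c) ∈ S α ↔ Formula.mem a b ∉ S α ∧ Formula.mem a c ∉ S α
  all : ∀ (α : Ordinal.{0}) (y : ℕ) (A : Formula),
    Formula.all y A ∈ S α ↔ ∀ a : Term, Formula.FreeFor a y A → Formula.subst a y A ∈ S α
  mem_T : ∀ (α : Ordinal.{0}) (u : Term),
    Formula.mem u .T ∈ S α ↔
      ∃ A : Formula, Formula.and (Formula.eq u A.quote) (Formula.tr A) ∈ S α
  mem_E : ∀ (α : Ordinal.{0}) (u : Term),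
    Formula.mem u .E ∈ S α ↔
      ∃ (a : Term) (n : ℕ),
        Formula.and (Formula.eq u (Term.pair (Term.numeral n) a)) (Formula.eq a (.v n)) ∈ S α

/-- `{A | γ ⊨ 𝕋A}`. -/
def truths (S : Ordinal.{0} → Set Formula) (γ : Ordinal.{0}) : Set Formula :=
  {A | A.tr ∈ S γ}

/-- The formulas that are in `truths S γ` for all large enough `γ`. -/
def IN (S : Ordinal.{0} → Set Formula) : Set Formula :=
  {A | ∃ β, ∀ γ, β ≤ γ → A ∈ truths S γ}

/-- The formulas that are outside `truths S γ` for all large enough `γ`. -/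
def OUT (S : Ordinal.{0} → Set Formula) : Set Formula :=
  {A | ∃ β, ∀ γ, β ≤ γ → A ∉ truths S γ}

/-- The unstable formulas. -/
def UNSTAB (S : Ordinal.{0} → Set Formula) : Set Formula := (IN S ∪ OUT S)ᶜ

/-- The limit ordinal `κ` covers `S`. -/
def Covers (S : Ordinal.{0} → Set Formula) (κ : Ordinal.{0}) : Prop :=
  Order.IsSuccLimit κ ∧ ∀ γ, κ ≤ γ → IN S ⊆ truths S γ ∧ truths S γ ⊆ IN S ∪ UNSTAB S

/-- The limit ordinal `σ` stabilizes `S`. -/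
def Stabilizes (S : Ordinal.{0} → Set Formula) (σ : Ordinal.{0}) : Prop :=
  Covers S σ ∧ truths S σ ⊆ IN S

/-- The closure ordinal: the least stabilizing ordinal. -/
noncomputable def koppa (S : Ordinal.{0} → Set Formula) : Ordinal.{0} := sInf {σ | Stabilizes S σ}

/-- `A` is a maxim: the truth of `A` holds at the closure ordinal. -/
def Maxim (S : Ordinal.{0} → Set Formula) (A : Formula) : Prop := A.tr ∈ S (koppa S)

/-! ## Semantic sequences exist

The existence of a semantic sequence is proved below by recursion on the ordinals, so that
`IsSemantics` is not vacuous. -/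

/-- The nesting depth of a formula, not counting what is inside terms. -/
def Formula.depth : Formula → ℕ
  | .app _ _ => 0
  | .nor A B => A.depth + B.depth + 1
  | .all _ A => A.depth + 1

theorem Formula.depth_subst (a : Term) (u : ℕ) : ∀ A : Formula, (Formula.subst a u A).depth = A.depth
  | .app b c => by simp [Formula.subst, Formula.depth]
  | .nor A B => by
      simp [Formula.subst, Formula.depth, Formula.depth_subst a u A, Formula.depth_subst a u B]
  | .all y A => by
      rw [Formula.subst]; split_ifs
      · rfl
      · simp [Formula.depth, Formula.depth_subst a u A]

section

variable (K : Term → ℕ → Formula → Prop) (L : Formula → Prop)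

/-- Identity of `a` and `b`, given which terms belong to which abstracts. -/
def ident (a b : Term) : Prop := ∀ u A, K a u A ↔ K b u A

/-- Membership at an ordinal, given membership in abstracts (`K`) and the formulas whose truth
holds (`L`). -/
def memR (a : Term) : Term → Prop
  | .T => ∃ A : Formula, ident K a A.quote ∧ L A
  | .E => ∃ (c : Term) (n : ℕ), ident K a (Term.pair (Term.numeral n) c) ∧ ident K c (.v n)
  | .v _ => False
  | .nor b c => ¬ memR a b ∧ ¬ memR a c
  | .abs u A => K a u A

/-- Satisfaction at an ordinal, given `K` and `L`. -/
def sat : Formula → Prop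
  | .app b a => memR K L a b
  | .nor A B => ¬ sat A ∧ ¬ sat B
  | .all y A => ∀ a : Term, Formula.FreeFor a y A → sat (Formula.subst a y A)
termination_by A => A.depth
decreasing_by
  all_goals simp only [Formula.depth, Formula.depth_subst]; omega

theorem memR_congr {a b : Term} (h : ident K a b) : ∀ c : Term, memR K L a c ↔ memR K L b c
  | .T => by
      simp only [memR]
      exact exists_congr fun A => and_congr_left fun _ =>
        ⟨fun k u A => (h u A).symm.trans (k u A), fun k u A => (h u A).trans (k u A)⟩
  | .E => by
      simp only [memR]
      exact exists_congr fun A => exists_congr fun n => and_congr_left fun _ =>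
        ⟨fun k u A => (h u A).symm.trans (k u A), fun k u A => (h u A).trans (k u A)⟩
  | .v _ => by simp [memR]
  | .nor c d => by simp only [memR, memR_congr h c, memR_congr h d]
  | .abs u A => by simp only [memR]; exact h u A

theorem fresh_notMem (s : Finset ℕ) : fresh s ∉ s := by
  have : ({n | n ∉ s} : Set ℕ).Nonempty := by
    obtain ⟨n, hn⟩ := Infinite.exists_notMem_finset s
    exact ⟨n, hn⟩
  exact Nat.sInf_mem this

mutual
theorem Term.subst_of_notMem (a : Term) (u : ℕ) : ∀ b : Term, u ∉ b.nun → Term.subst a u b = b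
  | .T, _ => by simp [Term.subst]
  | .E, _ => by simp [Term.subst]
  | .v n, h => by
      simp only [Term.nun, Finset.mem_singleton] at h
      simp [Term.subst, h]
  | .nor b c, h => by
      simp only [Term.nun, Finset.mem_union, not_or] at h
      simp [Term.subst, Term.subst_of_notMem a u b h.1, Term.subst_of_notMem a u c h.2]
  | .abs y A, h => by
      simp only [Term.nun, Finset.mem_sdiff, Finset.mem_singleton, not_and, not_not] at h
      rw [Term.subst]; split_ifs with hy
      · rfl
      · rw [Formula.subst_of_notMem a u A (fun k => hy (h k))]
theorem Formula.subst_of_notMem (a : Term) (u : ℕ) :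
    ∀ A : Formula, u ∉ A.nun → Formula.subst a u A = A
  | .app b c, h => by
      simp only [Formula.nun, Finset.mem_union, not_or] at h
      simp [Formula.subst, Term.subst_of_notMem a u b h.1, Term.subst_of_notMem a u c h.2]
  | .nor A B, h => by
      simp only [Formula.nun, Finset.mem_union, not_or] at h
      simp [Formula.subst, Formula.subst_of_notMem a u A h.1, Formula.subst_of_notMem a u B h.2]
  | .all y A, h => by
      simp only [Formula.nun, Finset.mem_sdiff, Finset.mem_singleton, not_and, not_not] at h
      rw [Formula.subst]; split_ifs with hy
      · rfl
      · rw [Formula.subst_of_notMem a u A (fun k => hy (h k))]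
end

mutual
theorem Term.freeFor_of_notMem (a : Term) (u : ℕ) : ∀ b : Term, u ∉ b.nun → Term.FreeFor a u b
  | .T, _ => trivial
  | .E, _ => trivial
  | .v n, h => trivial
  | .nor b c, h => by
      simp only [Term.nun, Finset.mem_union, not_or] at h
      exact ⟨Term.freeFor_of_notMem a u b h.1, Term.freeFor_of_notMem a u c h.2⟩
  | .abs y A, h => by
      simp only [Term.nun] at h
      exact Or.inl h
theorem Formula.freeFor_of_notMem (a : Term) (u : ℕ) :
    ∀ A : Formula, u ∉ A.nun → Formula.FreeFor a u A
  | .app b c, h => by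
      simp only [Formula.nun, Finset.mem_union, not_or] at h
      exact ⟨Term.freeFor_of_notMem a u b h.1, Term.freeFor_of_notMem a u c h.2⟩
  | .nor A B, h => by
      simp only [Formula.nun, Finset.mem_union, not_or] at h
      exact ⟨Formula.freeFor_of_notMem a u A h.1, Formula.freeFor_of_notMem a u B h.2⟩
  | .all y A, h => by
      simp only [Formula.nun] at h
      exact Or.inl h
end

theorem sat_app (a b : Term) : sat K L (.app b a) ↔ memR K L a b := by rw [sat]
theorem sat_nor (A B) : sat K L (.nor A B) ↔ ¬ sat K L A ∧ ¬ sat K L B := by rw [sat]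
theorem sat_all (y A) : sat K L (.all y A) ↔
    ∀ a : Term, Formula.FreeFor a y A → sat K L (Formula.subst a y A) := by rw [sat]

theorem sat_and (A B) : sat K L (Formula.and A B) ↔ sat K L A ∧ sat K L B := by
  simp only [Formula.and, sat_nor]; tauto
theorem sat_imp (A B) : sat K L (Formula.imp A B) ↔ (sat K L A → sat K L B) := by
  simp only [Formula.imp, sat_nor]; tauto

theorem sat_eq (a b : Term) : sat K L (Formula.eq a b) ↔ ident K a b := by
  have hu := fresh_notMem (a.nun ∪ b.nun)
  simp only [Finset.mem_union, not_or] at hu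
  have ha := fun c => Term.subst_of_notMem c _ a hu.1
  have hb := fun c => Term.subst_of_notMem c _ b hu.2
  have fa := fun c => Term.freeFor_of_notMem c _ a hu.1
  have fb := fun c => Term.freeFor_of_notMem c _ b hu.2
  have key : sat K L (Formula.eq a b) ↔ ∀ c : Term, memR K L a c → memR K L b c := by
    simp only [Formula.eq]
    rw [sat_all]
    refine forall_congr' fun c => ?_
    have hs : Formula.subst c (fresh (a.nun ∪ b.nun))
        (Formula.imp (Formula.mem a (.v (fresh (a.nun ∪ b.nun))))
        (Formula.mem b (.v (fresh (a.nun ∪ b.nun))))) =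
        Formula.imp (Formula.mem a c) (Formula.mem b c) := by
      simp [Formula.imp, Formula.mem, Formula.subst, Term.subst, ha, hb]
    have hf : Formula.FreeFor c (fresh (a.nun ∪ b.nun))
        (Formula.imp (Formula.mem a (.v (fresh (a.nun ∪ b.nun))))
        (Formula.mem b (.v (fresh (a.nun ∪ b.nun))))) := by
      simp [Formula.imp, Formula.mem, Formula.FreeFor, Term.FreeFor, fa, fb]
    rw [hs, sat_imp]; simp only [hf, true_imp_iff]; simp only [Formula.mem, sat_app]
  rw [key]
  refine ⟨fun h u A => ⟨fun k => ?_, fun k => ?_⟩, fun h c => (memR_congr K L h c).1⟩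
  · simpa [memR] using h (.abs u A) (by simpa [memR] using k)
  · by_contra hn
    have := h (.nor (.abs u A) (.abs u A)) (by simpa [memR] using hn)
    simp [memR] at this
    exact this k

end

/-- A semantic sequence, in which noemata have no members. -/
noncomputable def seq (α : Ordinal.{0}) : Set Formula :=
  {A | sat
    (fun a u B => Formula.FreeFor a u B ∧
      ∃ β < α, ∀ γ, β ≤ γ → (h : γ < α) → Formula.subst a u B ∈ seq γ)
    (fun B => ∃ β < α, ∀ γ, β ≤ γ → (h : γ < α) → B ∈ seq γ) A}
termination_by α

theorem exists_isSemantics : ∃ S, IsSemantics S := by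
  have tr_iff (K L) (A : Formula) : sat K L A.tr ↔ ∃ a, K a (fresh A.nun) A := by
    have hy := fresh_notMem A.nun
    have hs (c) : Formula.subst c (fresh A.nun) (Formula.neg (Formula.mem (.v (fresh A.nun))
        (.abs (fresh A.nun) A))) = Formula.neg (Formula.mem c (.abs (fresh A.nun) A)) := by
      simp [Formula.neg, Formula.mem, Formula.subst, Term.subst]
    have hf (c) : Formula.FreeFor c (fresh A.nun) (Formula.neg (Formula.mem (.v (fresh A.nun))
        (.abs (fresh A.nun) A))) := by
      simp [Formula.neg, Formula.mem, Formula.FreeFor, Term.FreeFor]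
    simp only [Formula.tr, Formula.ex]
    rw [Formula.neg, sat_nor, sat_all]
    simp only [hs, hf, true_imp_iff]
    simp only [Formula.neg, Formula.mem, sat_nor, sat_app, memR]
    push Not; simp
  obtain ⟨K, L, hK, hL, mem_seq⟩ : ∃ (K : Ordinal.{0} → Term → ℕ → Formula → Prop)
      (L : Ordinal.{0} → Formula → Prop),
      (∀ α a u B, K α a u B ↔ Formula.FreeFor a u B ∧
        ∃ β < α, ∀ γ, β ≤ γ → γ < α → Formula.subst a u B ∈ seq γ) ∧
      (∀ α B, L α B ↔ ∃ β < α, ∀ γ, β ≤ γ → γ < α → B ∈ seq γ) ∧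
      ∀ α A, A ∈ seq α ↔ sat (K α) (L α) A :=
    ⟨_, _, fun _ _ _ _ => Iff.rfl, fun _ _ => Iff.rfl, fun α A => by rw [seq]; rfl⟩
  refine ⟨seq, ?_, ?_, ?_, ?_, ?_, ?_⟩
  · intro α a u A; rw [mem_seq, Formula.mem, sat_app, memR, hK]
  · intro α A B; simp only [mem_seq, sat_nor]
  · intro α a b c; simp only [mem_seq, Formula.mem, sat_app, memR]
  · intro α y A; simp only [mem_seq, sat_all]
  · intro α u
    simp only [mem_seq, Formula.mem, sat_app, memR, sat_and, sat_eq, tr_iff]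
    refine exists_congr fun A => and_congr_right fun _ => ?_
    have hy := fresh_notMem A.nun
    simp only [hK, hL, Formula.subst_of_notMem _ _ _ hy]
    exact ⟨fun h => ⟨.T, Formula.freeFor_of_notMem _ _ _ hy, h⟩, fun ⟨_, _, h⟩ => h⟩
  · intro α u
    simp only [mem_seq, Formula.mem, sat_app, memR, sat_and, sat_eq]

/-- The noema `v₀` is not identical with `T` at the ordinal `1`: `T ∈ {v₁ | ∀ v₀ (v₁ ∈ v₀ → v₁ ∈ v₀)}`,
but `v₀` is not substitutable there.  So no clause making `v₀ = T` hold at every ordinal is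
compatible with the other clauses, and none is imposed. -/
theorem noema_ne {S : Ordinal.{0} → Set Formula} (hS : IsSemantics S) : Formula.eq (.v 0) .T ∉ S 1 := by
  have imp_iff (α A B) : Formula.imp A B ∈ S α ↔ (A ∈ S α → B ∈ S α) := by
    simp only [Formula.imp, hS.nor]; tauto
  have hu : fresh ((Term.v 0).nun ∪ Term.T.nun) ≠ 0 := by
    have := fresh_notMem ((Term.v 0).nun ∪ Term.T.nun)
    intro h; rw [h] at this; simp [Term.nun] at this
  have mem_of (h : Formula.eq (.v 0) .T ∈ S 1) (c : Term) :
      Formula.mem (.v 0) c ∈ S 1 → Formula.mem .T c ∈ S 1 := by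
    simp only [Formula.eq] at h
    have := (hS.all _ _ _).1 h c (by simp [Formula.imp, Formula.mem, Formula.FreeFor, Term.FreeFor])
    simpa [Formula.imp, Formula.mem, Formula.subst, Term.subst, hu, ← imp_iff] using this
  intro h
  let R : Formula := .all 0 (.imp (.mem (.v 1) (.v 0)) (.mem (.v 1) (.v 0)))
  let c : Term := .abs 1 R
  have hT : Formula.mem .T c ∈ S 1 := by
    rw [hS.mem_abs]
    refine ⟨by simp [R, Formula.imp, Formula.mem, Formula.FreeFor, Term.FreeFor, Term.nun], 0, by simp, ?_⟩
    intro γ _ _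
    simp only [R, Formula.subst, Formula.imp, Formula.mem, Term.subst]
    norm_num
    rw [hS.all]
    intro a _
    exact (imp_iff γ (.app a .T) (.app a .T)).2 id
  have hv : Formula.mem (.v 0) c ∉ S 1 := by
    rw [hS.mem_abs]
    rintro ⟨h, -⟩
    simp [R, Formula.imp, Formula.mem, Formula.FreeFor, Term.FreeFor, Term.nun, Formula.nun] at h
  have := mem_of h (.nor c c) ((hS.mem_nor _ _ _ _).2 ⟨hv, hv⟩)
  exact ((hS.mem_nor _ _ _ _).1 this).1 hT

end Libra

namespace Libra

-- The sentence finds its own number through the index of a noema. If a string has number `p`,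
-- appending the noema `v p`, a bar with `p + 5` dots, yields the number `(2 p + 1) 2 ^ (p + 5)`. So
-- a formula made of a prefix with number `p` followed by `v p` can recover `p` from `v p` by the
-- enumerator, and then compute its own number. `Formula.diagonal` says that `A` holds of every
-- number not excluded by `Term.miscoded`; with this choice of noema only the formula's own number
-- is left. No substitution function on codes is needed.
--
-- The arithmetic must work at all large ordinals. Identity persists downwards (`Indisc.mono`), so
-- each pair of terms is either identical at every ordinal or distinct from some ordinal on, and one
-- bound serves all pairs (`exists_indisc_imp_same`). Beyond it, abstracts built from identity have
-- settled members, one ordinal later for each further nesting. This gives the numerals, the set of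
-- numbers (`exists_arithmetical`), and the graph of `n ↦ (2 n + 1) 2 ^ (n + 5)`
-- (`Arithmetical.graph_iff`). That graph is defined by quantifying over sets of triples closed
-- under certain rules; cofinite sets, all of which are given by terms, suffice to refute wrong
-- values.
--
-- The equivalence therefore holds at all large ordinals, its truth lies in `IN`, and the closure
-- ordinal, which exists by `exists_stabilizes`, covers `IN`.

theorem exists_uniform_bound {ι : Type} {p : ι → Ordinal.{0} → Prop}
    (h : ∀ i, ∃ β, ∀ γ, β ≤ γ → p i γ) : ∃ β, ∀ γ, β ≤ γ → ∀ i, p i γ := by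
  choose f hf using h
  -- The index type is small relative to the ordinals, so the supremum bounds the whole family.
  exact ⟨⨆ i, f i, fun γ hγ i => hf i γ ((Ordinal.le_iSup f i).trans hγ)⟩

/-! ## Connectives, substitution and substitutability -/

/-- `∀ u (a ∈ u → b ∈ u)`. -/
def Formula.leib (u : ℕ) (a b : Term) : Formula :=
  .all u (.imp (.mem a (.v u)) (.mem b (.v u)))

section syntactic

variable (a : Term) (u : ℕ)

@[simp] theorem subst_neg (A : Formula) :
    Formula.subst a u (.neg A) = .neg (Formula.subst a u A) := by
  simp [Formula.neg, Formula.subst]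

@[simp] theorem subst_nor (A B : Formula) :
    Formula.subst a u (.nor A B) = .nor (Formula.subst a u A) (Formula.subst a u B) := by
  simp [Formula.subst]

@[simp] theorem subst_or (A B : Formula) :
    Formula.subst a u (.or A B) = .or (Formula.subst a u A) (Formula.subst a u B) := by
  simp [Formula.or, Formula.subst]

@[simp] theorem subst_and (A B : Formula) :
    Formula.subst a u (.and A B) = .and (Formula.subst a u A) (Formula.subst a u B) := by
  simp [Formula.and, Formula.subst]

@[simp] theorem subst_imp (A B : Formula) :
    Formula.subst a u (.imp A B) = .imp (Formula.subst a u A) (Formula.subst a u B) := by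
  simp [Formula.imp, Formula.subst]

@[simp] theorem subst_mem (b c : Term) :
    Formula.subst a u (.mem b c) = .mem (Term.subst a u b) (Term.subst a u c) := by
  simp [Formula.mem, Formula.subst]

@[simp] theorem subst_v_self : Term.subst a u (.v u) = a := by simp [Term.subst]

theorem subst_v_ne {n : ℕ} (h : u ≠ n) : Term.subst a u (.v n) = .v n := by
  simp [Term.subst, h]

@[simp] theorem subst_T : Term.subst a u .T = .T := by simp [Term.subst]

@[simp] theorem subst_E : Term.subst a u .E = .E := by simp [Term.subst]

theorem subst_all {y : ℕ} (h : u ≠ y) (A : Formula) :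
    Formula.subst a u (.all y A) = .all y (Formula.subst a u A) := by
  simp [Formula.subst, h]

theorem subst_abs {y : ℕ} (h : u ≠ y) (A : Formula) :
    Term.subst a u (.abs y A) = .abs y (Formula.subst a u A) := by
  simp [Term.subst, h]

theorem subst_ex {y : ℕ} (h : u ≠ y) (A : Formula) :
    Formula.subst a u (.ex y A) = .ex y (Formula.subst a u A) := by
  simp [Formula.ex, subst_all _ _ h]

@[simp] theorem freeFor_neg (A : Formula) :
    Formula.FreeFor a u (.neg A) ↔ Formula.FreeFor a u A := by
  simp [Formula.neg, Formula.FreeFor]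

@[simp] theorem freeFor_or (A B : Formula) :
    Formula.FreeFor a u (.or A B) ↔ Formula.FreeFor a u A ∧ Formula.FreeFor a u B := by
  simp [Formula.or, Formula.FreeFor]

@[simp] theorem freeFor_and (A B : Formula) :
    Formula.FreeFor a u (.and A B) ↔ Formula.FreeFor a u A ∧ Formula.FreeFor a u B := by
  simp [Formula.and, Formula.FreeFor]

@[simp] theorem freeFor_imp (A B : Formula) :
    Formula.FreeFor a u (.imp A B) ↔ Formula.FreeFor a u A ∧ Formula.FreeFor a u B := by
  simp [Formula.imp, Formula.FreeFor]

@[simp] theorem freeFor_mem (b c : Term) :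
    Formula.FreeFor a u (.mem b c) ↔ Term.FreeFor a u b ∧ Term.FreeFor a u c := by
  simp [Formula.mem, Formula.FreeFor, and_comm]

@[simp] theorem freeFor_v (n : ℕ) : Term.FreeFor a u (.v n) := by simp [Term.FreeFor]

@[simp] theorem freeFor_E : Term.FreeFor a u .E := by simp [Term.FreeFor]

@[simp] theorem freeFor_T : Term.FreeFor a u .T := by simp [Term.FreeFor]

theorem freeFor_all (y : ℕ) (A : Formula) : Formula.FreeFor a u (.all y A) ↔
    u ∉ A.nun \ {y} ∨ (y ∉ a.nun ∧ Formula.FreeFor a u A) := by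
  simp only [Formula.FreeFor]

theorem freeFor_ex (y : ℕ) (A : Formula) : Formula.FreeFor a u (.ex y A) ↔
    u ∉ A.nun \ {y} ∨ (y ∉ a.nun ∧ Formula.FreeFor a u A) := by
  simp [Formula.ex, Formula.neg, Formula.nun, Formula.FreeFor]

@[simp] theorem nun_neg (A : Formula) : (Formula.neg A).nun = A.nun := by
  simp [Formula.neg, Formula.nun]

@[simp] theorem nun_or (A B : Formula) : (Formula.or A B).nun = A.nun ∪ B.nun := by
  simp [Formula.or, Formula.nun]

@[simp] theorem nun_and (A B : Formula) : (Formula.and A B).nun = A.nun ∪ B.nun := by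
  simp [Formula.and, Formula.nun]

@[simp] theorem nun_imp (A B : Formula) : (Formula.imp A B).nun = A.nun ∪ B.nun := by
  simp [Formula.imp, Formula.nun]

@[simp] theorem nun_mem (b c : Term) : (Formula.mem b c).nun = b.nun ∪ c.nun := by
  simp [Formula.mem, Formula.nun, Finset.union_comm]

end syntactic

mutual
theorem Term.freeFor_of_closed {a : Term} (ha : a.nun = ∅) (u : ℕ) : ∀ b : Term, Term.FreeFor a u b
  | .T => by simp
  | .E => by simp
  | .v n => by simp
  | .nor b c => ⟨Term.freeFor_of_closed ha u b, Term.freeFor_of_closed ha u c⟩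
  | .abs y A => Or.inr ⟨by simp [ha], Formula.freeFor_of_closed ha u A⟩
theorem Formula.freeFor_of_closed {a : Term} (ha : a.nun = ∅) (u : ℕ) :
    ∀ A : Formula, Formula.FreeFor a u A
  | .app b c => ⟨Term.freeFor_of_closed ha u b, Term.freeFor_of_closed ha u c⟩
  | .nor A B => ⟨Formula.freeFor_of_closed ha u A, Formula.freeFor_of_closed ha u B⟩
  | .all y A => Or.inr ⟨by simp [ha], Formula.freeFor_of_closed ha u A⟩
end

theorem fresh_le_card (s : Finset ℕ) : fresh s ≤ s.card := by
  by_contra! h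
  have : Finset.range (s.card + 1) ⊆ s := fun i hi => by
    by_contra hn
    exact Nat.notMem_of_lt_sInf (lt_of_lt_of_le (Finset.mem_range.1 hi) h) hn
  simpa using Finset.card_le_card this

/-! ## Satisfaction of the defined connectives -/

abbrev Sequence : Type 1 := Ordinal.{0} → Set Formula

variable {S : Sequence} {γ : Ordinal.{0}}

theorem IsSemantics.neg (hS : IsSemantics S) (A : Formula) : A.neg ∈ S γ ↔ A ∉ S γ := by
  simp [Formula.neg, hS.nor]

theorem IsSemantics.or (hS : IsSemantics S) (A B : Formula) :
    A.or B ∈ S γ ↔ A ∈ S γ ∨ B ∈ S γ := by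
  simp only [Formula.or, hS.nor]; tauto

theorem IsSemantics.and (hS : IsSemantics S) (A B : Formula) :
    A.and B ∈ S γ ↔ A ∈ S γ ∧ B ∈ S γ := by
  simp only [Formula.and, hS.nor]; tauto

theorem IsSemantics.imp (hS : IsSemantics S) (A B : Formula) :
    A.imp B ∈ S γ ↔ (A ∈ S γ → B ∈ S γ) := by
  simp only [Formula.imp, hS.nor]; tauto

theorem IsSemantics.iff (hS : IsSemantics S) (A B : Formula) :
    A.iff B ∈ S γ ↔ (A ∈ S γ ↔ B ∈ S γ) := by
  simp only [Formula.iff, hS.and, hS.imp]; tauto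

theorem IsSemantics.ex (hS : IsSemantics S) (y : ℕ) (A : Formula) :
    A.ex y ∈ S γ ↔ ∃ a, Formula.FreeFor a y A ∧ Formula.subst a y A ∈ S γ := by
  simp only [Formula.ex, hS.neg, hS.all, freeFor_neg, subst_neg]
  push Not; rfl

/-- The noema bound in `Formula.tr` is not present in `A`, so every term is substitutable for it
without effect, and any term serves as witness. -/
theorem IsSemantics.tr (hS : IsSemantics S) (A : Formula) :
    A.tr ∈ S γ ↔ ∃ β < γ, ∀ δ, β ≤ δ → δ < γ → A ∈ S δ := by
  have hy := fresh_notMem A.nun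
  simp only [Formula.tr, hS.ex, subst_mem, subst_v_self, freeFor_mem, freeFor_v, true_and]
  have h (a : Term) : Term.subst a (fresh A.nun) (.abs (fresh A.nun) A) = .abs (fresh A.nun) A := by
    simp [Term.subst]
  simp only [h, hS.mem_abs, Formula.subst_of_notMem _ _ _ hy]
  exact ⟨fun ⟨_, _, _, h⟩ => h, fun h => ⟨.T, by simp [Term.FreeFor],
    Formula.freeFor_of_notMem _ _ _ hy, h⟩⟩

/-- Membership in an abstract whose defining formula has a settled truth value. -/
theorem IsSemantics.mem_abs_of_settled (hS : IsSemantics S) {θ : Ordinal.{0}} {a : Term} {u : ℕ}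
    {A : Formula} {P : Prop}
    (h : Formula.FreeFor a u A → ∀ δ, θ ≤ δ → (Formula.subst a u A ∈ S δ ↔ P)) (hγ : θ < γ) :
    Formula.mem a (.abs u A) ∈ S γ ↔ Formula.FreeFor a u A ∧ P := by
  rw [hS.mem_abs]
  refine and_congr_right fun hf => ⟨fun ⟨β, hβ, k⟩ => ?_, fun hP => ⟨θ, hγ, fun δ hδ _ =>
    (h hf δ hδ).2 hP⟩⟩
  -- The final segment given by `β`, cut to start at `θ` or later, is still nonempty below `γ`.
  exact (h hf (max β θ) (le_max_right _ _)).1 (k _ (le_max_left _ _) (max_lt hβ hγ))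

/-! ## Indiscernibility -/

/-- `a` and `b` are identical at `γ`. -/
def Indisc (S : Sequence) (γ : Ordinal.{0}) (a b : Term) : Prop :=
  ∀ c, Formula.mem a c ∈ S γ ↔ Formula.mem b c ∈ S γ

/-- `a` and `b` are identical at every ordinal. -/
def Same (S : Sequence) (a b : Term) : Prop := ∀ γ, Indisc S γ a b

theorem Same.refl (a : Term) : Same S a a := fun _ _ => Iff.rfl

theorem Same.symm {a b : Term} (h : Same S a b) : Same S b a := fun γ c => (h γ c).symm

theorem Same.trans {a b c : Term} (h : Same S a b) (k : Same S b c) : Same S a c :=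
  fun γ d => (h γ d).trans (k γ d)

theorem Same.congr_right {a b c : Term} (h : Same S a b) : Same S c a ↔ Same S c b :=
  ⟨fun k => k.trans h, fun k => k.trans h.symm⟩

theorem IsSemantics.leib (hS : IsSemantics S) {u : ℕ} {a b : Term} (ha : u ∉ a.nun)
    (hb : u ∉ b.nun) : Formula.leib u a b ∈ S γ ↔ Indisc S γ a b := by
  have key : Formula.leib u a b ∈ S γ ↔ ∀ c, Formula.mem a c ∈ S γ → Formula.mem b c ∈ S γ := by
    rw [Formula.leib, hS.all]
    refine forall_congr' fun c => ?_
    simp [Term.freeFor_of_notMem c u _ ha, Term.freeFor_of_notMem c u _ hb,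
      Term.subst_of_notMem c u _ ha, Term.subst_of_notMem c u _ hb, hS.imp]
  rw [key]
  refine ⟨fun h c => ⟨h c, fun k => ?_⟩, fun h c => (h c).1⟩
  by_contra hn
  -- The juncture `↓cc` is the complement of `c`, which makes Leibnizian identity symmetric.
  have := h (.nor c c) ((hS.mem_nor _ _ _ _).2 ⟨hn, hn⟩)
  exact ((hS.mem_nor _ _ _ _).1 this).1 k

theorem IsSemantics.eq (hS : IsSemantics S) (a b : Term) :
    Formula.eq a b ∈ S γ ↔ Indisc S γ a b := by
  have h := fresh_notMem (a.nun ∪ b.nun)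
  simp only [Finset.mem_union, not_or] at h
  exact hS.leib h.1 h.2

theorem nun_leib (u : ℕ) (a b : Term) : (Formula.leib u a b).nun = (a.nun ∪ b.nun) \ {u} := by
  ext n; simp [Formula.leib, Formula.nun, Term.nun]; tauto

theorem freeFor_leib (c : Term) (y u : ℕ) (b : Term) : Formula.FreeFor c y (.leib u (.v y) b) ↔
    y = u ∨ (u ∉ c.nun ∧ Term.FreeFor c y b) := by
  simp [Formula.leib, Formula.FreeFor, Term.nun]

theorem subst_leib (c : Term) {y u : ℕ} (h : y ≠ u) (a b : Term) :
    Formula.subst c y (.leib u a b) = .leib u (Term.subst c y a) (Term.subst c y b) := by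
  rw [Formula.leib, subst_all _ _ h]; simp [subst_v_ne _ _ h, Formula.leib]

theorem exists_fresh_pair (s : Finset ℕ) : ∃ y u, y ∉ s ∧ u ∉ s ∧ y ≠ u := by
  obtain ⟨y, hy⟩ := Infinite.exists_notMem_finset s
  obtain ⟨u, hu⟩ := Infinite.exists_notMem_finset (insert y s)
  simp only [Finset.mem_insert, not_or] at hu
  exact ⟨y, u, hy, hu.2, fun h => hu.1 h.symm⟩

/-- Identity persists downwards. -/
theorem Indisc.mono (hS : IsSemantics S) {a b : Term} {δ : Ordinal.{0}} (h : Indisc S δ a b)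
    (hγ : γ ≤ δ) : Indisc S γ a b := by
  by_contra hn
  induction δ using WellFoundedLT.induction with
  | ind δ ih =>
    rcases hγ.eq_or_lt with rfl | hlt
    · exact hn h
    obtain ⟨y, u, hy, hu, hyu⟩ := exists_fresh_pair (a.nun ∪ b.nun)
    simp only [Finset.mem_union, not_or] at hy hu
    have hsub (c : Term) : Formula.subst c y (.neg (.leib u (.v y) a)) = .neg (.leib u c a) := by
      simp [subst_leib _ hyu, Term.subst_of_notMem _ _ _ hy.1]
    have hfree (c : Term) (hc : u ∉ c.nun) : Formula.FreeFor c y (.neg (.leib u (.v y) a)) := by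
      rw [freeFor_neg, freeFor_leib]; exact Or.inr ⟨hc, Term.freeFor_of_notMem _ _ _ hy.1⟩
    -- By induction `a` and `b` are distinct throughout `[γ, δ)`, so `b` is in `{y | y ≠ a}` at `δ`.
    -- Identity at `δ` puts `a` there too, and `a ≠ a` would hold below `δ`.
    have hb : Formula.mem b (.abs y (.neg (.leib u (.v y) a))) ∈ S δ := by
      rw [hS.mem_abs]
      refine ⟨hfree b hu.2, γ, hlt, fun ε hε hεδ => ?_⟩
      rw [hsub, hS.neg, hS.leib hu.2 hu.1]
      exact fun k => ih ε hεδ (fun c => (k c).symm) hε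
    have ha := (h _).2 hb
    rw [hS.mem_abs] at ha
    obtain ⟨-, β, hβ, k⟩ := ha
    have := k β le_rfl hβ
    rw [hsub, hS.neg, hS.leib hu.1 hu.1] at this
    exact this fun _ => Iff.rfl

theorem exists_indisc_imp_same (hS : IsSemantics S) :
    ∃ θ, ∀ γ, θ ≤ γ → ∀ a b, Indisc S γ a b → Same S a b := by
  have : ∃ θ, ∀ γ, θ ≤ γ → ∀ q : Term × Term, Indisc S γ q.1 q.2 → Same S q.1 q.2 := by
    refine exists_uniform_bound fun q => ?_
    by_cases h : Same S q.1 q.2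
    · exact ⟨0, fun _ _ _ => h⟩
    · simp only [Same, not_forall] at h
      obtain ⟨β, hβ⟩ := h
      exact ⟨β, fun γ hγ k => (hβ (k.mono hS hγ)).elim⟩
  obtain ⟨θ, h⟩ := this
  exact ⟨θ, fun γ hγ a b => h γ hγ (a, b)⟩

/-- Substitutivity of identicals. -/
theorem Same.subst_iff (hS : IsSemantics S) {a b : Term} (h : Same S a b) {u : ℕ} {A : Formula}
    (ha : Formula.FreeFor a u A) (hb : Formula.FreeFor b u A) :
    Formula.subst a u A ∈ S γ ↔ Formula.subst b u A ∈ S γ := by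
  -- Membership in an abstract at `succ γ` is satisfaction at `γ`, which alone fills a final segment
  -- below `succ γ`.
  have key (c : Term) (hc : Formula.FreeFor c u A) :
      Formula.mem c (.abs u A) ∈ S (Order.succ γ) ↔ Formula.subst c u A ∈ S γ := by
    rw [hS.mem_abs]
    refine ⟨fun ⟨_, β, hβ, k⟩ => k γ (Order.lt_succ_iff.1 hβ) (Order.lt_succ γ), fun k =>
      ⟨hc, γ, Order.lt_succ γ, fun δ h₁ h₂ => ?_⟩⟩
    rwa [le_antisymm (Order.lt_succ_iff.1 h₂) h₁]
  rw [← key a ha, ← key b hb]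
  exact h _ _

theorem Same.mem_right (hS : IsSemantics S) {a b : Term} (h : Same S a b) (c : Term) :
    Formula.mem c a ∈ S γ ↔ Formula.mem c b ∈ S γ := by
  obtain ⟨u, hu⟩ := Infinite.exists_notMem_finset c.nun
  have := h.subst_iff hS (γ := γ) (u := u) (A := .mem c (.v u))
    (by simp [Term.freeFor_of_notMem _ _ _ hu]) (by simp [Term.freeFor_of_notMem _ _ _ hu])
  simpa [Term.subst_of_notMem _ _ _ hu] using this

/-- Identical terms have the same noemata present. -/
theorem Same.nun_eq (hS : IsSemantics S) {a b : Term} (h : Same S a b) : a.nun = b.nun := by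
  ext n
  -- The defining formula is valid wherever substitution is allowed, so membership at `1` only tests
  -- substitutability; the quantifier on `v n` excludes just the terms in which `v n` is present.
  have key (c : Term) :
      Formula.mem c (.abs (n + 1) (.leib n (.v (n + 1)) (.v (n + 1)))) ∈ S 1 ↔ n ∉ c.nun := by
    rw [hS.mem_abs, freeFor_leib]
    simp only [freeFor_v, Nat.succ_ne_self, false_or, and_true]
    refine ⟨And.left, fun hn => ⟨hn, 0, by simp, fun γ _ _ => ?_⟩⟩
    rw [subst_leib _ (by simp), subst_v_self, hS.leib hn hn]
    exact fun _ => Iff.rfl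
  have := h 1 (.abs (n + 1) (.leib n (.v (n + 1)) (.v (n + 1))))
  rw [key, key] at this
  exact not_iff_not.1 this


/-! ## The closure ordinal -/

/-- Past some `θ` every stable formula has its final status. From there, take `ω` steps, each long
enough for every formula outside `IN` to fail to be true at least once. Truth at the limit requires
the formula to hold on a final segment below it, hence to be true at all later ordinals below it, so
only formulas of `IN` are true there. -/
theorem exists_stabilizes (hS : IsSemantics S) : ∃ σ, Stabilizes S σ := by
  obtain ⟨θ, hθ⟩ : ∃ θ, ∀ γ, θ ≤ γ → ∀ A : Formula,
      (A ∈ IN S → A ∈ truths S γ) ∧ (A ∈ OUT S → A ∉ truths S γ) := by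
    refine exists_uniform_bound fun A => ?_
    by_cases h₁ : A ∈ IN S
    · obtain ⟨β, hβ⟩ := h₁
      exact ⟨β, fun γ hγ => ⟨fun _ => hβ γ hγ, fun ⟨δ, hδ⟩ =>
        (hδ _ (le_max_right β δ) (hβ _ (le_max_left β δ))).elim⟩⟩
    by_cases h₂ : A ∈ OUT S
    · obtain ⟨β, hβ⟩ := h₂
      exact ⟨β, fun γ hγ => ⟨fun h => (h₁ h).elim, fun _ => hβ γ hγ⟩⟩
    · exact ⟨0, fun _ _ => ⟨fun h => (h₁ h).elim, fun h => (h₂ h).elim⟩⟩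
  have next (α : Ordinal.{0}) : ∃ β, α < β ∧ ∀ A : Formula, A ∉ IN S →
      ∃ δ, α < δ ∧ δ < β ∧ A ∉ truths S δ := by
    obtain ⟨β, hβ⟩ := exists_uniform_bound
      (p := fun (A : Formula) β => α < β ∧ (A ∉ IN S → ∃ δ, α < δ ∧ δ < β ∧ A ∉ truths S δ))
      (fun A => by
        by_cases h : A ∈ IN S
        · exact ⟨Order.succ α, fun γ hγ => ⟨Order.succ_le_iff.1 hγ, fun k => (k h).elim⟩⟩
        · have h' := h
          simp only [IN, Set.mem_ofPred_eq, not_exists, not_forall] at h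
          obtain ⟨δ, hδ, hA⟩ := h (Order.succ α)
          have hδ := Order.succ_le_iff.1 hδ
          exact ⟨Order.succ δ, fun γ hγ => ⟨hδ.trans (Order.succ_le_iff.1 hγ),
            fun _ => ⟨δ, hδ, Order.succ_le_iff.1 hγ, hA⟩⟩⟩)
    -- The bound `α < β` does not depend on the formula, so an arbitrary one extracts it.
    exact ⟨β, (hβ β le_rfl (.app .T .T)).1, fun A => (hβ β le_rfl A).2⟩
  choose f hf hfA using next
  let g : ℕ → Ordinal.{0} := fun n => f^[n] θ
  have hg (n) : g (n + 1) = f (g n) := Function.iterate_succ_apply' f n θ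
  have hlt (n) : g n < g (n + 1) := by rw [hg]; exact hf _
  have hle (n) : g n ≤ ⨆ n, g n := Ordinal.le_iSup g n
  have hex {α} (h : α < ⨆ n, g n) : ∃ n, α < g n := Ordinal.lt_iSup_iff.1 h
  have hlim : Order.IsSuccLimit (⨆ n, g n) := by
    refine ⟨fun h => ?_, ?_⟩
    · exact not_lt_bot ((h.eq_bot) ▸ (hlt 0).trans_le (hle 1))
    · intro α hα
      obtain ⟨n, hn⟩ := hex hα.lt
      exact hα.2 hn ((hlt n).trans_le (hle _))
  refine ⟨⨆ n, g n, ⟨hlim, fun γ hγ => ⟨fun A hA => (hθ γ ((hle 0).trans hγ) A).1 hA,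
    fun A hA => ?_⟩⟩, fun A hA => ?_⟩
  · by_cases h : A ∈ IN S
    · exact Or.inl h
    · exact Or.inr fun k => k.elim h fun k => (hθ γ ((hle 0).trans hγ) A).2 k hA
  · by_contra hI
    obtain ⟨β, hβ, k⟩ := (hS.tr A).1 hA
    obtain ⟨n, hn⟩ := hex hβ
    obtain ⟨δ, h₁, h₂, h₃⟩ := hfA (g n) A hI
    have hδ : δ < ⨆ n, g n := h₂.trans_le (hg n ▸ hle (n + 1))
    exact h₃ ((hS.tr A).2 ⟨β, hn.trans h₁, fun ε h₄ h₅ => k ε h₄ (h₅.trans hδ)⟩)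

/-- What holds at all large enough ordinals is a maxim. -/
theorem maxim_of_eventually (hS : IsSemantics S) {A : Formula}
    (h : ∃ β, ∀ γ, β ≤ γ → A ∈ S γ) : Maxim S A := by
  obtain ⟨β, hβ⟩ := h
  have hst : Stabilizes S (koppa S) := csInf_mem (exists_stabilizes hS)
  refine (hst.1.2 _ le_rfl).1 ⟨Order.succ β, fun γ hγ => (hS.tr A).2
    ⟨β, Order.succ_le_iff.1 hγ, fun δ hδ _ => hβ δ hδ⟩⟩

/-! ## Singletons, numerals and the set of numbers -/

/-- `{v₀ | v₀ = a}`. -/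
def Term.sing (a : Term) : Term := .abs 0 (.leib 1 (.v 0) a)

/-- `{v₀ | v₀ ∈ a ∨ v₀ = a}`. -/
def Term.suc (a : Term) : Term := .abs 0 (.or (.mem (.v 0) a) (.leib 1 (.v 0) a))

/-- The set of numbers, `{v₀ | ∃ v₁ (v₁ ∈ T ∧ v₀ ∈ v₁)}`. -/
def Term.nat : Term := .abs 0 (.ex 1 (.and (.mem (.v 1) .T) (.mem (.v 0) (.v 1))))

theorem numeral_succ (n : ℕ) : Term.numeral (n + 1) = (Term.numeral n).suc := rfl

@[simp] theorem nun_numeral : ∀ n, (Term.numeral n).nun = ∅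
  | 0 => by decide
  | n + 1 => by
    simp [Term.numeral, Term.nun, nun_numeral n, Formula.nun]

@[simp] theorem nun_nat : Term.nat.nun = ∅ := by decide

@[simp] theorem subst_numeral (a : Term) (u n : ℕ) :
    Term.subst a u (.numeral n) = .numeral n :=
  Term.subst_of_notMem _ _ _ (by simp)

@[simp] theorem subst_nat (a : Term) (u : ℕ) : Term.subst a u .nat = .nat :=
  Term.subst_of_notMem _ _ _ (by simp)

@[simp] theorem freeFor_numeral (a : Term) (u n : ℕ) : Term.FreeFor a u (.numeral n) :=
  Term.freeFor_of_notMem _ _ _ (by simp)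

/-- Identity is absolute from `θ` on. -/
def Settled (S : Sequence) (θ : Ordinal.{0}) : Prop :=
  ∀ γ, θ ≤ γ → ∀ a b, Indisc S γ a b → Same S a b

theorem Settled.indisc {θ : Ordinal.{0}} (h : Settled S θ) (hγ : θ ≤ γ) (a b : Term) :
    Indisc S γ a b ↔ Same S a b := ⟨h γ hγ a b, fun k => k γ⟩

theorem Settled.mem_sing (hS : IsSemantics S) {θ : Ordinal.{0}} (h : Settled S θ) (hγ : θ < γ)
    {a c : Term} (h₀ : 0 ∉ c.nun) (h₁ : 1 ∉ c.nun) :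
    Formula.mem a c.sing ∈ S γ ↔ Same S a c := by
  rw [Term.sing, hS.mem_abs_of_settled (P := Same S a c) _ hγ, freeFor_leib]
  · exact ⟨And.right, fun k => ⟨Or.inr ⟨k.nun_eq hS ▸ h₁, Term.freeFor_of_notMem _ _ _ h₀⟩, k⟩⟩
  · intro hf δ hδ
    rw [freeFor_leib] at hf
    simp only [zero_ne_one, false_or] at hf
    rw [subst_leib _ zero_ne_one, subst_v_self, Term.subst_of_notMem _ _ _ h₀, hS.leib hf.1 h₁,
      h.indisc hδ]

/-- The two conditions on `a` express substitutability: the noemata quantified in the two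
identities, which `fresh` makes depend on `b` and `c`, must not be present in `a`. -/
theorem Settled.mem_upair (hS : IsSemantics S) {θ : Ordinal.{0}} (h : Settled S θ) (hγ : θ < γ)
    (a b c : Term) : Formula.mem a (.upair b c) ∈ S γ ↔
      (fresh ({fresh (b.nun ∪ c.nun)} ∪ b.nun) ∉ a.nun ∧
        fresh ({fresh (b.nun ∪ c.nun)} ∪ c.nun) ∉ a.nun) ∧ (Same S a b ∨ Same S a c) := by
  set x := fresh (b.nun ∪ c.nun) with hx
  have hx' := fresh_notMem (b.nun ∪ c.nun)
  rw [← hx, Finset.mem_union, not_or] at hx'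
  have key (d : Term) (hd : x ∉ d.nun) :
      Formula.eq (.v x) d = .leib (fresh ({x} ∪ d.nun)) (.v x) d ∧
      fresh ({x} ∪ d.nun) ∉ d.nun ∧ x ≠ fresh ({x} ∪ d.nun) ∧
      (Formula.FreeFor a x (Formula.eq (.v x) d) ↔ fresh ({x} ∪ d.nun) ∉ a.nun) := by
    have hu := fresh_notMem ({x} ∪ d.nun)
    simp only [Finset.mem_union, Finset.mem_singleton, not_or] at hu
    refine ⟨rfl, hu.2, Ne.symm hu.1, ?_⟩
    change Formula.FreeFor a x (.leib _ _ _) ↔ _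
    rw [freeFor_leib]
    simp only [Ne.symm hu.1, false_or, and_iff_left_iff_imp, Term.nun]
    exact fun _ => Term.freeFor_of_notMem _ _ _ hd
  obtain ⟨eb, hb₁, hb₂, hb₃⟩ := key b hx'.1
  obtain ⟨ec, hc₁, hc₂, hc₃⟩ := key c hx'.2
  rw [show Term.upair b c = .abs x (.or (.eq (.v x) b) (.eq (.v x) c)) from rfl,
    hS.mem_abs_of_settled (P := Same S a b ∨ Same S a c) _ hγ, freeFor_or, hb₃, hc₃]
  intro hf δ hδ
  rw [freeFor_or, hb₃, hc₃] at hf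
  rw [subst_or, eb, ec, hS.or, subst_leib _ hb₂, subst_leib _ hc₂, subst_v_self,
    Term.subst_of_notMem _ _ _ hx'.1, Term.subst_of_notMem _ _ _ hx'.2, hS.leib hf.1 hb₁,
    hS.leib hf.2 hc₁, h.indisc hδ, h.indisc hδ]

/-- Each numeral is an abstract over the preceding one, so its members are settled one ordinal
later; hence `θ + n`. -/
theorem Settled.mem_numeral (hS : IsSemantics S) {θ : Ordinal.{0}} (h : Settled S θ) (n : ℕ) :
    ∀ {γ : Ordinal.{0}}, θ + n < γ → ∀ a : Term,
      (Formula.mem a (.numeral n) ∈ S γ ↔ ∃ k < n, Same S a (.numeral k)) := by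
  induction n with
  | zero =>
    intro γ _ a
    simp only [not_lt_zero, false_and, exists_false, iff_false, Term.numeral, hS.mem_abs]
    rintro ⟨hf, β, hβ, k⟩
    have := k β le_rfl hβ
    simp only [freeFor_neg, Formula.FreeFor] at hf
    rw [subst_neg, hS.neg, subst_all _ _ zero_ne_one, hS.all] at this
    exact this fun b _ => by simp [hS.imp]
  | succ n ih =>
    intro γ hγ a
    have hP : (∃ k < n + 1, Same S a (.numeral k)) ↔
        (∃ k < n, Same S a (.numeral k)) ∨ Same S a (.numeral n) := by
      simp only [Nat.lt_succ_iff_lt_or_eq, or_and_right, exists_or, exists_eq_left]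
    have hθ : θ + (n : Ordinal.{0}) < θ + ((n + 1 : ℕ) : Ordinal.{0}) :=
      by simp
    rw [numeral_succ, Term.suc, hS.mem_abs_of_settled _ hγ, and_iff_right_of_imp]
    -- Identity with a closed numeral forces `a` to be closed, so substitutability is automatic.
    · rintro ⟨k, -, hk⟩
      have : a.nun = ∅ := by simp [hk.nun_eq hS]
      exact Formula.freeFor_of_closed this _ _
    · intro hf δ hδ
      simp only [freeFor_or, freeFor_leib, zero_ne_one, false_or] at hf
      rw [subst_or, hS.or, subst_leib _ zero_ne_one, subst_mem, subst_v_self, subst_numeral,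
        hS.leib hf.2.1 (by simp), ih (hθ.trans_le hδ), hP,
        h.indisc (le_self_add.trans (hθ.le.trans hδ))]

/-- If numerals of `k < n` were identical, that of `k` would belong to itself, hence be identical
with that of some `j < k`; this descends. -/
theorem Settled.numeral_inj (hS : IsSemantics S) {θ : Ordinal.{0}} (h : Settled S θ) {m n : ℕ}
    (hmn : Same S (.numeral m) (.numeral n)) : m = n := by
  have key : ∀ n k, k < n → ¬ Same S (.numeral k) (.numeral n) := by
    intro n
    induction n using Nat.strong_induction_on with
    | _ n ih =>
      intro k hk hs
      -- The ordinal is chosen to lie beyond both `θ + n` and `θ + k`.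
      have h₁ := (h.mem_numeral hS n (γ := Order.succ (θ + n + k)) (by simp)
        (.numeral k)).2 ⟨k, hk, .refl _⟩
      rw [← hs.mem_right hS, h.mem_numeral hS k] at h₁
      · obtain ⟨j, hj, hjk⟩ := h₁
        exact ih k hk j hj hjk.symm
      · rw [Order.lt_succ_iff]
        gcongr
        simp
  rcases lt_trichotomy m n with h' | h' | h'
  · exact (key _ _ h' hmn).elim
  · exact h'
  · exact (key _ _ h' hmn.symm).elim

theorem le_cat_left (m n : ℕ) : m ≤ cat m n :=
  (Nat.le_mul_of_pos_right m (by positivity)).trans (Nat.le_add_right _ _)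

theorem le_cat_right (m n : ℕ) : n ≤ cat m n := Nat.le_add_left _ _

/-- `Term.nat` is in effect the union of `T`. The members of `T` are the numerals of true formulas,
and their members are the smaller numbers, so unbounded codes of valid formulas make every number
appear. -/
theorem exists_valid_code_gt (hS : IsSemantics S) (k : ℕ) :
    ∃ A : Formula, k < A.code ∧ ∀ γ, A ∈ S γ := by
  refine ⟨.imp (.mem .T (.v k)) (.mem .T (.v k)), ?_, fun γ => by simp [hS.imp]⟩
  have h₁ : k < 2 ^ (k + 5) := Nat.lt_two_pow_self.trans (Nat.pow_lt_pow_right (by simp) (by simp))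
  simp only [Formula.imp, Formula.mem, Formula.code, Term.code]
  refine h₁.trans_le ?_
  refine le_trans ?_ (le_cat_right _ _)
  refine le_trans ?_ (le_cat_right _ _)
  refine le_trans ?_ (le_cat_right _ _)
  refine le_trans ?_ (le_cat_right _ _)
  exact le_cat_left _ _

/-- An ordinal from which the numerals behave as numbers. -/
structure Arithmetical (S : Sequence) (θ : Ordinal.{0}) : Prop where
  settled : Settled S θ
  mem_numeral : ∀ γ, θ ≤ γ → ∀ a n,
    Formula.mem a (.numeral n) ∈ S γ ↔ ∃ k < n, Same S a (.numeral k)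
  mem_nat : ∀ γ, θ ≤ γ → ∀ a, Formula.mem a .nat ∈ S γ ↔ ∃ n, Same S a (.numeral n)

theorem Settled.mem_T (hS : IsSemantics S) {θ : Ordinal.{0}} (h : Settled S θ) (hγ : θ ≤ γ)
    (a : Term) : Formula.mem a .T ∈ S γ ↔ ∃ A : Formula, Same S a A.quote ∧ A.tr ∈ S γ := by
  simp only [hS.mem_T, hS.and, hS.eq, h.indisc hγ]

theorem exists_arithmetical (hS : IsSemantics S) : ∃ θ, Arithmetical S θ := by
  obtain ⟨θ, h : Settled S θ⟩ := exists_indisc_imp_same hS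
  have hlt {γ : Ordinal.{0}} (hγ : θ + Ordinal.omega0 ≤ γ) (n : ℕ) : θ + n < γ :=
    lt_of_lt_of_le (by simp) hγ
  -- At `θ + ω` all numerals are settled; the abstract `Term.nat` costs one more ordinal.
  refine ⟨Order.succ (θ + Ordinal.omega0), fun γ hγ => h γ ?_, fun γ hγ a n =>
    h.mem_numeral hS n (hlt ((Order.le_succ _).trans hγ) n) a, fun γ hγ a => ?_⟩
  · exact (by simp : θ < _).le.trans ((Order.le_succ _).trans hγ)
  rw [Term.nat, hS.mem_abs_of_settled (P := ∃ n, Same S a (.numeral n)) _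
    (Order.succ_le_iff.1 hγ), and_iff_right_of_imp]
  · rintro ⟨k, hk⟩
    exact Formula.freeFor_of_closed (by simp [hk.nun_eq hS]) _ _
  intro hf δ hδ
  simp only [freeFor_ex, nun_and, nun_mem, Term.nun] at hf
  have h₁ : 1 ∉ a.nun := by simpa using hf
  have hθ : θ < δ := by simpa using hlt hδ 0
  simp only [subst_ex _ _ zero_ne_one, subst_and, subst_mem, subst_v_self, subst_T,
    subst_v_ne _ _ zero_ne_one, hS.ex, Term.subst_of_notMem _ _ _ h₁, hS.and,
    h.mem_T hS hθ.le]
  constructor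
  · rintro ⟨b, -, ⟨A, hA, -⟩, hab⟩
    rw [hA.mem_right hS, Formula.quote, h.mem_numeral hS _ (hlt hδ _)] at hab
    obtain ⟨k, -, hk⟩ := hab
    exact ⟨k, hk⟩
  · rintro ⟨k, hk⟩
    obtain ⟨A, hA, hv⟩ := exists_valid_code_gt hS k
    refine ⟨A.quote, Formula.freeFor_of_closed (by simp [Formula.quote]) _ _,
      ⟨A, .refl _, (hS.tr A).2 ⟨θ, hθ, fun ε _ _ => hv ε⟩⟩, ?_⟩
    rw [Formula.quote, h.mem_numeral hS _ (hlt hδ _)]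
    exact ⟨k, hA, hk⟩

/-! ## Quantification over numbers -/

/-- `∀ y (y ∈ nat → A)`. -/
def Formula.allNat (y : ℕ) (A : Formula) : Formula := .all y (.imp (.mem (.v y) .nat) A)

theorem subst_allNat (a : Term) {u y : ℕ} (h : u ≠ y) (A : Formula) :
    Formula.subst a u (.allNat y A) = .allNat y (Formula.subst a u A) := by
  simp [Formula.allNat, subst_all _ _ h, subst_v_ne _ _ h]

theorem nun_allNat (y : ℕ) (A : Formula) : (Formula.allNat y A).nun = A.nun \ {y} := by
  ext n; simp [Formula.allNat, Formula.nun, Term.nun]; tauto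

theorem freeFor_allNat (a : Term) (u y : ℕ) (A : Formula) : Formula.FreeFor a u (.allNat y A) ↔
    u ∉ A.nun \ {y} ∨ (y ∉ a.nun ∧ Formula.FreeFor a u A) := by
  simp [Formula.allNat, freeFor_all, Term.nun]
  tauto

/-- A universal quantifier whose matrix holds of everything but numbers. -/
theorem Arithmetical.all_iff (hS : IsSemantics S) {θ : Ordinal.{0}} (h : Arithmetical S θ)
    (hγ : θ ≤ γ) (y : ℕ) (A : Formula)
    (hA : ∀ a, Formula.mem a .nat ∉ S γ → Formula.subst a y A ∈ S γ) :
    Formula.all y A ∈ S γ ↔ ∀ n, Formula.subst (.numeral n) y A ∈ S γ := by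
  rw [hS.all]
  refine ⟨fun k n => k _ (Formula.freeFor_of_closed (by simp) _ _), fun k a hf => ?_⟩
  by_cases ha : Formula.mem a .nat ∈ S γ
  · obtain ⟨n, hn⟩ := (h.mem_nat γ hγ a).1 ha
    exact (hn.subst_iff hS hf (Formula.freeFor_of_closed (by simp) _ _)).2 (k n)
  · exact hA a ha

theorem Arithmetical.allNat_iff (hS : IsSemantics S) {θ : Ordinal.{0}} (h : Arithmetical S θ)
    (hγ : θ ≤ γ) (y : ℕ) (A : Formula) :
    Formula.allNat y A ∈ S γ ↔ ∀ n, Formula.subst (.numeral n) y A ∈ S γ := by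
  rw [Formula.allNat, h.all_iff hS hγ]
  · refine forall_congr' fun n => ?_
    rw [subst_imp, hS.imp, subst_mem, subst_v_self, subst_nat, h.mem_nat γ hγ]
    exact ⟨fun k => k ⟨n, .refl _⟩, fun k _ => k⟩
  · intro a ha
    rw [subst_imp, hS.imp, subst_mem, subst_v_self, subst_nat]
    exact fun k => (ha k).elim


/-! ## Triples of numbers -/

theorem subst_suc (d : Term) {u : ℕ} (h₀ : u ≠ 0) (h₁ : u ≠ 1) (a : Term) :
    Term.subst d u a.suc = (Term.subst d u a).suc := by
  simp [Term.suc, subst_abs _ _ h₀, subst_leib _ h₁, subst_v_ne _ _ h₀]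

/-- A term from which the numbers `a`, `b`, `c` can be recovered, by means of the noemata
`x + 8`, `x + 9`, `x + 10`. -/
def Term.triple (x : ℕ) (a b c : Term) : Term :=
  .abs (x + 7) (.or (.and (.mem (.v (x + 8)) (.v (x + 7))) (.mem a (.v (x + 7))))
    (.or (.and (.mem (.v (x + 9)) (.v (x + 7))) (.mem b (.v (x + 7))))
      (.and (.mem (.v (x + 10)) (.v (x + 7))) (.mem c (.v (x + 7))))))

/-- The bound noema of a triple is fixed, so substitution goes straight into the components. In a
Kuratowski pair the bound noemata are chosen by `fresh` and change with the components. -/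
theorem subst_triple (d : Term) {u x : ℕ} (h : u < x + 7) (a b c : Term) :
    Term.subst d u (.triple x a b c) =
      .triple x (Term.subst d u a) (Term.subst d u b) (Term.subst d u c) := by
  rw [Term.triple, subst_abs _ _ (by omega)]
  simp [subst_v_ne _ _ (show u ≠ x + 7 by omega), subst_v_ne _ _ (show u ≠ x + 8 by omega),
    subst_v_ne _ _ (show u ≠ x + 9 by omega), subst_v_ne _ _ (show u ≠ x + 10 by omega),
    Term.triple]

theorem nun_triple (x : ℕ) (a b c : Term) : (Term.triple x a b c).nun =
    ({x + 8, x + 9, x + 10} ∪ a.nun ∪ b.nun ∪ c.nun) \ {x + 7} := by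
  ext n; simp [Term.triple, Term.nun]; tauto

/-- The triple of three numbers. -/
def Term.natTriple (x i j k : ℕ) : Term :=
  .triple x (.numeral i) (.numeral j) (.numeral k)

theorem nun_natTriple (x i j k : ℕ) :
    (Term.natTriple x i j k).nun = {x + 8, x + 9, x + 10} := by
  ext n; simp [Term.natTriple, nun_triple]; omega

/-- `{v s, ⌜l⌝}`. -/
def Term.tagged (s l : ℕ) : Term :=
  .nor (.nor (Term.v s).sing (Term.numeral l).sing) (.nor (Term.v s).sing (Term.numeral l).sing)

theorem same_v_iff (hS : IsSemantics S) (m n : ℕ) : Same S (.v m) (.v n) ↔ m = n := by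
  refine ⟨fun h => ?_, fun h => h ▸ .refl _⟩
  simpa [Term.nun] using h.nun_eq hS

theorem not_same_v_numeral (hS : IsSemantics S) (m n : ℕ) : ¬ Same S (.v m) (.numeral n) := by
  intro h
  simpa [Term.nun] using h.nun_eq hS

theorem Arithmetical.same_numeral_iff (hS : IsSemantics S) {θ : Ordinal.{0}}
    (h : Arithmetical S θ) (m n : ℕ) : Same S (.numeral m) (.numeral n) ↔ m = n :=
  ⟨h.settled.numeral_inj hS, fun k => k ▸ .refl _⟩

theorem Arithmetical.mem_tagged (hS : IsSemantics S) {θ : Ordinal.{0}} (h : Arithmetical S θ)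
    (hγ : θ < γ) {s : ℕ} (hs : 2 ≤ s) (l : ℕ) (a : Term) :
    Formula.mem a (.tagged s l) ∈ S γ ↔ Same S a (.v s) ∨ Same S a (.numeral l) := by
  rw [Term.tagged, hS.mem_nor, hS.mem_nor,
    h.settled.mem_sing hS hγ (by simp [Term.nun]; omega) (by simp [Term.nun]; omega),
    h.settled.mem_sing hS hγ (by simp) (by simp), and_self, ← not_or, not_not]

/-- Noemata mark the coordinates: distinct noemata are never identical, nor is a noema identical
with a closed numeral. So `{v s, ⌜l⌝}` satisfies at most the disjunct marked by `v s`, and only if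
that coordinate is `l`. -/
theorem Arithmetical.tagged_mem_natTriple (hS : IsSemantics S) {θ : Ordinal.{0}}
    (h : Arithmetical S θ) (hγ : Order.succ θ < γ) {s : ℕ} (hs : 2 ≤ s) (x l i j k : ℕ) :
    Formula.mem (.tagged s l) (.natTriple x i j k) ∈ S γ ↔
      (x + 8 = s ∧ i = l) ∨ (x + 9 = s ∧ j = l) ∨ (x + 10 = s ∧ k = l) := by
  rw [Term.natTriple, Term.triple, hS.mem_abs_of_settled _ hγ, and_iff_right_of_imp]
  · intro _; simp
  · intro _ δ hδ
    have hδ := Order.succ_le_iff.1 hδ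
    have hv (m : ℕ) (hm : x + 7 ≠ m) := subst_v_ne (.tagged s l) (x + 7) hm
    simp [hv, hS.or, hS.and, h.mem_tagged hS hδ hs, same_v_iff hS, not_same_v_numeral hS,
      h.same_numeral_iff hS, mt Same.symm (not_same_v_numeral hS _ _)]

theorem Arithmetical.natTriple_inj (hS : IsSemantics S) {θ : Ordinal.{0}} (h : Arithmetical S θ)
    {x i j k i' j' k' : ℕ} (hs : Same S (.natTriple x i j k) (.natTriple x i' j' k')) :
    i = i' ∧ j = j' ∧ k = k' := by
  have key (s l : ℕ) (h₂ : 2 ≤ s) :=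
    (h.tagged_mem_natTriple hS (Order.lt_succ (Order.succ θ)) h₂ x l i j k).symm.trans
      ((hs.mem_right hS _).trans
        (h.tagged_mem_natTriple hS (Order.lt_succ (Order.succ θ)) h₂ x l i' j' k'))
  have h₁ := key (x + 8) i (by omega)
  have h₂ := key (x + 9) j (by omega)
  have h₃ := key (x + 10) k (by omega)
  simp at h₁ h₂ h₃
  exact ⟨h₁.symm, h₂.symm, h₃.symm⟩

/-- Every cofinite set of triples is given by a term. -/
theorem Arithmetical.exists_cofinite (hS : IsSemantics S) {θ : Ordinal.{0}}
    (h : Arithmetical S θ) (x : ℕ) (s : Finset (ℕ × ℕ × ℕ)) :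
    ∃ U : Term, U.nun ⊆ {x + 8, x + 9, x + 10} ∧ ∀ γ, θ < γ → ∀ i j k,
      (Formula.mem (.natTriple x i j k) U ∈ S γ ↔ (i, j, k) ∉ s) := by
  induction s using Finset.induction_on with
  | empty =>
    refine ⟨.nor (.numeral 0) (.numeral 0), by simp [Term.nun], fun γ hγ i j k => ?_⟩
    simp [hS.mem_nor, h.mem_numeral γ hγ.le]
  | insert q s _ ih =>
    obtain ⟨U, hU, hmem⟩ := ih
    obtain ⟨i', j', k'⟩ := q
    refine ⟨.nor (Term.natTriple x i' j' k').sing (.nor U U), ?_, fun γ hγ i j k => ?_⟩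
    · simp only [Term.nun, Finset.union_self]
      refine Finset.union_subset ?_ hU
      simp only [Term.sing, Term.nun, nun_leib, nun_natTriple]
      intro n
      simp
      tauto
    · rw [hS.mem_nor, h.settled.mem_sing hS hγ (by simp [nun_natTriple])
        (by simp [nun_natTriple]), hS.mem_nor, hmem γ hγ]
      have : Same S (.natTriple x i j k) (.natTriple x i' j' k') ↔ (i, j, k) = (i', j', k') := by
        refine ⟨fun hs => ?_, fun hs => ?_⟩
        · simpa using h.natTriple_inj hS hs
        · obtain ⟨rfl, rfl, rfl⟩ := by simpa using hs
          exact .refl _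
      rw [this, Finset.mem_insert]
      tauto

/-! ## The function `n ↦ (2 n + 1) 2 ^ (n + 5)` -/

/-- `v (x + 2)` contains `(0, 1, a)`, and it contains `(i, j + 2, k)` with `(i, j, k + 1)` and
`(i + 1, 0, j)` with `(i, j, 0)`. -/
def Formula.closure (x : ℕ) (a : Term) : Formula :=
  .and (.mem (.triple x (.numeral 0) (.numeral 1) a) (.v (x + 2)))
    (.and (.allNat (x + 4) (.allNat (x + 5) (.allNat (x + 6)
        (.imp (.mem (.triple x (.v (x + 4)) (.v (x + 5)) (Term.v (x + 6)).suc) (.v (x + 2)))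
          (.mem (.triple x (.v (x + 4)) (Term.v (x + 5)).suc.suc (.v (x + 6))) (.v (x + 2)))))))
      (.allNat (x + 4) (.allNat (x + 5)
        (.imp (.mem (.triple x (.v (x + 4)) (.v (x + 5)) (.numeral 0)) (.v (x + 2)))
          (.mem (.triple x (Term.v (x + 4)).suc (.numeral 0) (.v (x + 5))) (.v (x + 2)))))))

/-- `b` is the number `(2 a + 1) 2 ^ (a + 5)`. -/
def Formula.graph (x : ℕ) (a b : Term) : Formula :=
  .all (x + 2) (.imp (.closure x a)
    (.mem (.triple x a.suc.suc.suc.suc.suc b (.numeral 0)) (.v (x + 2))))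

/-- What `Formula.closure` says of a set of triples of numbers. -/
structure IsClosure (n : ℕ) (R : ℕ → ℕ → ℕ → Prop) : Prop where
  init : R 0 1 n
  shift : ∀ i j k, R i j (k + 1) → R i (j + 2) k
  next : ∀ i j, R i j 0 → R (i + 1) 0 j

/-- The rules preserve `j + 2 k = (2 n + 1) 2 ^ i`: `k` is a counter and `j` accumulates twos, so
doubling is expressed with successor alone. -/
theorem IsClosure.mem {n : ℕ} {R : ℕ → ℕ → ℕ → Prop} (h : IsClosure n R) (i : ℕ) :
    R i ((2 * n + 1) * 2 ^ i) 0 := by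
  have shift (i k : ℕ) : ∀ j, R i j k → R i (j + 2 * k) 0 := by
    induction k with
    | zero => exact fun j hj => hj
    | succ k ih =>
      intro j hj
      have := ih _ (h.shift i j k hj)
      rwa [show j + 2 * (k + 1) = j + 2 + 2 * k by ring]
  induction i with
  | zero => simpa [add_comm] using shift 0 n 1 h.init
  | succ i ih =>
    have := shift _ _ _ (h.next _ _ ih)
    rwa [show (2 * n + 1) * 2 ^ (i + 1) = 0 + 2 * ((2 * n + 1) * 2 ^ i) by ring]

/-- The triples that violate the invariant within the bounds `i` and `m` form a finite set
containing `(i, m, 0)`. Any rule whose result lies in it has its premise in it, so the complement is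
closed. -/
theorem exists_isClosure {n i m : ℕ} (hm : m ≠ (2 * n + 1) * 2 ^ i) :
    ∃ s : Finset (ℕ × ℕ × ℕ), IsClosure n (fun i j k => (i, j, k) ∉ s) ∧ (i, m, 0) ∈ s := by
  have hfin : {q : ℕ × ℕ × ℕ | q.1 ≤ i ∧ q.2.1 + 2 * q.2.2 ≤ m ∧
      q.2.1 + 2 * q.2.2 ≠ (2 * n + 1) * 2 ^ q.1}.Finite := by
    refine (Set.finite_Icc (0, 0, 0) (i, m, m)).subset fun ⟨a, b, c⟩ ⟨h₁, h₂, _⟩ => ?_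
    simp only [Set.mem_Icc, Prod.mk_le_mk]
    simp only at h₁ h₂
    omega
  refine ⟨hfin.toFinset, ⟨?_, ?_, ?_⟩, ?_⟩
  · simp; omega
  · intro i' j k
    simp only [Set.Finite.mem_toFinset]
    refine mt fun ⟨h₁, h₂, h₃⟩ => ⟨h₁, ?_, ?_⟩
    · simp only at h₂ ⊢; omega
    · simp only at h₃ ⊢
      intro h; apply h₃; rw [← h]; ring
  · intro i' j
    simp only [Set.Finite.mem_toFinset]
    refine mt fun ⟨h₁, h₂, h₃⟩ => ⟨?_, ?_, ?_⟩
    · simp only at h₁ ⊢; omega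
    · simp only at h₂ ⊢; omega
    · simp only at h₃ ⊢
      intro h; apply h₃; rw [pow_succ, ← mul_assoc, ← h]; ring
  · simpa using hm

theorem freeFor_closure (x n : ℕ) (U : Term) :
    Formula.FreeFor U (x + 2) (.closure x (.numeral n)) ↔
      x + 4 ∉ U.nun ∧ x + 5 ∉ U.nun ∧ x + 6 ∉ U.nun := by
  have key (a b c : Term) (ha : x + 2 ∉ a.nun) (hb : x + 2 ∉ b.nun) (hc : x + 2 ∉ c.nun) :
      Term.FreeFor U (x + 2) (.triple x a b c) :=
    Term.freeFor_of_notMem _ _ _ (by simp [nun_triple, ha, hb, hc])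
  have hsuc (a : Term) (ha : x + 2 ∉ a.nun) : x + 2 ∉ a.suc.nun := by
    simp [Term.suc, Term.nun, nun_leib, ha]
  have hv (m : ℕ) (hm : x + 2 ≠ m) : x + 2 ∉ (Term.v m).nun := by simpa [Term.nun] using hm
  have h₁ := key (.v (x + 4)) (.v (x + 5)) (Term.v (x + 6)).suc (hv _ (by omega)) (hv _ (by omega))
    (hsuc _ (hv _ (by omega)))
  have h₂ := key (.v (x + 4)) (Term.v (x + 5)).suc.suc (.v (x + 6)) (hv _ (by omega))
    (hsuc _ (hsuc _ (hv _ (by omega)))) (hv _ (by omega))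
  have h₃ := key (.v (x + 4)) (.v (x + 5)) (.numeral 0) (hv _ (by omega)) (hv _ (by omega))
    (by simp)
  have h₄ := key (Term.v (x + 4)).suc (.numeral 0) (.v (x + 5)) (hsuc _ (hv _ (by omega)))
    (by simp) (hv _ (by omega))
  have h₅ := key (.numeral 0) (.numeral 1) (.numeral n) (by simp) (by simp) (by simp)
  simp [Formula.closure, freeFor_allNat, nun_allNat, h₁, h₂, h₃, h₄, h₅, Term.nun]
  tauto

theorem Arithmetical.closure_iff (hS : IsSemantics S) {θ : Ordinal.{0}} (h : Arithmetical S θ)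
    (hγ : θ ≤ γ) {x : ℕ} (n : ℕ) {U : Term} (h₄ : x + 4 ∉ U.nun) (h₅ : x + 5 ∉ U.nun)
    (h₆ : x + 6 ∉ U.nun) : Formula.subst U (x + 2) (.closure x (.numeral n)) ∈ S γ ↔
      IsClosure n fun i j k => Formula.mem (.natTriple x i j k) U ∈ S γ := by
  have hU (c : Term) := And.intro (Term.subst_of_notMem c _ _ h₄)
    (And.intro (Term.subst_of_notMem c _ _ h₅) (Term.subst_of_notMem c _ _ h₆))
  have hv (c : Term) (m k : ℕ) (hm : m ≠ k) : Term.subst c m (.v k) = .v k := subst_v_ne _ _ hm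
  simp [Formula.closure, subst_allNat, subst_triple, subst_suc, hv, hS.and, hS.imp,
    h.allNat_iff hS hγ, hU, ← numeral_succ]
  exact ⟨fun ⟨a, b, c⟩ => ⟨a, b, c⟩, fun ⟨a, b, c⟩ => ⟨a, b, c⟩⟩

theorem Arithmetical.graph_iff (hS : IsSemantics S) {θ : Ordinal.{0}} (h : Arithmetical S θ)
    (hγ : θ < γ) (x n m : ℕ) :
    Formula.graph x (.numeral n) (.numeral m) ∈ S γ ↔ m = (2 * n + 1) * 2 ^ (n + 5) := by
  have hsub (U : Term) : Formula.subst U (x + 2) (.mem (.triple x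
      (Term.numeral n).suc.suc.suc.suc.suc (.numeral m) (.numeral 0)) (.v (x + 2))) =
      .mem (.natTriple x (n + 5) m 0) U := by
    simp only [← numeral_succ, subst_mem, subst_v_self]
    rw [Term.subst_of_notMem _ _ _ (by simp [nun_triple])]
    rfl
  rw [Formula.graph, hS.all]
  simp only [subst_imp, hS.imp, hsub, freeFor_imp, freeFor_closure]
  constructor
  · intro k
    by_contra hm
    obtain ⟨s, hs, hmem⟩ := exists_isClosure hm
    -- The quantifier ranges over terms, so the counterexample must be given by one; finiteness of
    -- the complement guarantees this.
    obtain ⟨U, hU, hUs⟩ := h.exists_cofinite hS x s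
    have hn (l : ℕ) (hl : l < x + 7) : l ∉ U.nun := fun hl' => by
      have := hU hl'
      simp at this
      omega
    have := k U ⟨⟨hn _ (by omega), hn _ (by omega), hn _ (by omega)⟩, ?_⟩ ?_
    · exact (hUs γ hγ _ _ _).1 this hmem
    · simp only [← numeral_succ, freeFor_mem, freeFor_v, and_true]
      exact Term.freeFor_of_notMem _ _ _ (by simp [nun_triple])
    · rw [h.closure_iff hS hγ.le n (hn _ (by omega)) (hn _ (by omega)) (hn _ (by omega))]
      simpa only [hUs γ hγ] using hs
  · rintro rfl U ⟨⟨h₄, h₅, h₆⟩, -⟩ hc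
    exact ((h.closure_iff hS hγ.le n h₄ h₅ h₆).1 hc).mem _

/-! ## The enumerator -/

/-- `b` is the number that the enumerator pairs with `a`. -/
def Formula.indexed (x : ℕ) (a b : Term) : Formula :=
  .ex (x + 12) (.ex (x + 13) (.and (.mem (.v (x + 12)) .E)
    (.and (.mem (.v (x + 13)) (.v (x + 12)))
      (.and (.mem a (.v (x + 13))) (.mem b (.v (x + 13)))))))

theorem nun_upair (a b : Term) : (Term.upair a b).nun = a.nun ∪ b.nun := by
  have h := fresh_notMem (a.nun ∪ b.nun)
  have key (c : Term) : (Formula.eq (.v (fresh (a.nun ∪ b.nun))) c).nun =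
      {fresh (a.nun ∪ b.nun)} ∪ c.nun := by
    change (Formula.leib _ _ _).nun = _
    rw [nun_leib]
    exact Finset.sdiff_eq_self_of_disjoint (Finset.disjoint_singleton_right.2 (fresh_notMem _))
  ext n
  simp only [Term.upair, Term.nun, nun_or, key, Finset.mem_sdiff, Finset.mem_union,
    Finset.mem_singleton]
  by_cases hn : n = fresh (a.nun ∪ b.nun)
  · subst hn; simpa using h
  · simp [hn]

/-- Terms in which at most `v n` is present make `Formula.eq` quantify a noema of index at most `2`,
so `3 ≤ n` excludes capture. -/
theorem fresh_le_two {s : Finset ℕ} {k n : ℕ} (h : s ⊆ {n}) : fresh ({k} ∪ s) ≤ 2 :=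
  (fresh_le_card _).trans ((Finset.card_union_le _ _).trans
    (by have := Finset.card_le_card h; simp at this ⊢; omega))

theorem Settled.mem_upair' (hS : IsSemantics S) {θ : Ordinal.{0}} (h : Settled S θ) (hγ : θ < γ)
    {n : ℕ} (hn : 3 ≤ n) {a b c : Term} (ha : a.nun ⊆ {n}) (hb : b.nun ⊆ {n}) (hc : c.nun ⊆ {n}) :
    Formula.mem a (.upair b c) ∈ S γ ↔ Same S a b ∨ Same S a c := by
  rw [h.mem_upair hS hγ, and_iff_right]
  have key (k : ℕ) (hk : k ≤ 2) : k ∉ a.nun := fun hk' => by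
    have := ha hk'
    simp at this
    omega
  exact ⟨key _ (fresh_le_two hb), key _ (fresh_le_two hc)⟩

/-- The enumerator contains only terms identical with some `⟨⌜m⌝, v m⟩`. A member of such a pair
that contains a noema and a number must be `{⌜m⌝, v m}`. -/
theorem Arithmetical.indexed_iff (hS : IsSemantics S) {θ : Ordinal.{0}} (h : Arithmetical S θ)
    (hγ : θ < γ) {x n : ℕ} (hn : x + 13 < n) (k : ℕ) :
    Formula.indexed x (.v n) (.numeral k) ∈ S γ ↔ k = n := by
  have hv (c : Term) (m k : ℕ) (hm : m ≠ k) : Term.subst c m (.v k) = .v k := subst_v_ne _ _ hm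
  have h₁ : x + 12 ≠ n := by omega
  have h₂ : x + 13 ≠ n := by omega
  have key : Formula.indexed x (.v n) (.numeral k) ∈ S γ ↔ ∃ e, x + 13 ∉ e.nun ∧ ∃ q,
      Formula.mem e .E ∈ S γ ∧ Formula.mem q e ∈ S γ ∧ Formula.mem (.v n) q ∈ S γ ∧
      Formula.mem (.numeral k) q ∈ S γ := by
    rw [Formula.indexed, hS.ex]
    refine exists_congr fun e => ?_
    rw [freeFor_ex]
    simp only [nun_and, nun_mem, Term.nun, freeFor_and, freeFor_mem, freeFor_v, freeFor_E,
      freeFor_numeral, and_true, subst_ex _ _ (show x + 12 ≠ x + 13 by omega)]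
    have : x + 12 ∉ (({x + 12} ∪ ∅ ∪ ({x + 13} ∪ {x + 12} ∪ ({n} ∪ {x + 13} ∪
      ((Term.numeral k).nun ∪ {x + 13})))) \ {x + 13} : Finset ℕ) ↔ False := by simp
    rw [this, false_or]
    refine and_congr_right fun he => ?_
    rw [hS.ex]
    refine exists_congr fun q => ?_
    simp [hv, h₁, h₂, hS.and, Term.subst_of_notMem _ _ _ he, Term.freeFor_of_notMem _ _ _ he]
  have hE (e : Term) : Formula.mem e .E ∈ S γ ↔ ∃ c m, Same S e (.pair (.numeral m) c) ∧
      Same S c (.v m) := by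
    simp only [hS.mem_E, hS.and, hS.eq, h.settled.indisc hγ.le]
  simp only [key, hE]
  constructor
  · rintro ⟨e, -, q, ⟨c, m, he, hc⟩, hq, hnq, hkq⟩
    rw [he.mem_right hS, Term.pair, h.settled.mem_upair hS hγ] at hq
    obtain hq | hq := hq.2
    -- The singleton of a numeral cannot contain a noema.
    · rw [hq.mem_right hS, h.settled.mem_upair hS hγ] at hnq
      exact (not_same_v_numeral hS _ _ (hnq.2.elim id id)).elim
    · rw [hq.mem_right hS, h.settled.mem_upair hS hγ, hc.congr_right, same_v_iff hS] at hnq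
      rw [hq.mem_right hS, h.settled.mem_upair hS hγ, hc.congr_right, h.same_numeral_iff hS] at hkq
      exact (hkq.2.resolve_right (mt Same.symm (not_same_v_numeral hS _ _))).trans
        (hnq.2.resolve_left (not_same_v_numeral hS _ _)).symm
  · rintro rfl
    have hk : (Term.numeral k).nun ⊆ {k} := by simp
    have hvk : (Term.v k).nun ⊆ {k} := by simp [Term.nun]
    refine ⟨.pair (.numeral k) (.v k), ?_, .upair (.numeral k) (.v k), ⟨_, _, .refl _, .refl _⟩,
      ?_, ?_, ?_⟩
    · simp [Term.pair, nun_upair, Term.nun]; omega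
    · rw [Term.pair, h.settled.mem_upair' hS hγ (n := k) (by omega)]
      · exact Or.inr (.refl _)
      all_goals simp [nun_upair, Term.nun]
    · rw [h.settled.mem_upair' hS hγ (n := k) (by omega) hvk hk hvk]
      exact Or.inr (.refl _)
    · rw [h.settled.mem_upair' hS hγ (n := k) (by omega) hk hk hvk]
      exact Or.inl (.refl _)


/-! ## The diagonal lemma -/

theorem size_cat (m n : ℕ) : Nat.size (cat m n) = Nat.size m + Nat.size n := by
  have hn := Nat.lt_size_self n
  rcases Nat.eq_zero_or_pos m with rfl | hm
  · simp [cat]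
  refine le_antisymm (Nat.size_le.2 ?_) ?_
  · have := Nat.lt_size_self m
    calc cat m n < m * 2 ^ Nat.size n + 2 ^ Nat.size n := by rw [cat]; omega
      _ = (m + 1) * 2 ^ Nat.size n := by ring
      _ ≤ 2 ^ Nat.size m * 2 ^ Nat.size n := Nat.mul_le_mul_right _ this
      _ = 2 ^ (Nat.size m + Nat.size n) := (pow_add _ _ _).symm
  · obtain ⟨k, hk⟩ : ∃ k, Nat.size m = k + 1 :=
      Nat.exists_eq_succ_of_ne_zero (Nat.size_pos.2 hm).ne'
    have hkm : 2 ^ k ≤ m := Nat.lt_size.1 (by omega)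
    have : k + Nat.size n < Nat.size (cat m n) := Nat.lt_size.2 <| by
      rw [pow_add]
      exact (Nat.mul_le_mul_right _ hkm).trans (Nat.le_add_right _ _)
    omega

theorem cat_assoc (a b c : ℕ) : cat (cat a b) c = cat a (cat b c) := by
  rw [cat, cat, cat, size_cat, cat, pow_add]
  ring

/-- `{y | for no number w that the enumerator pairs with y is v x the code attached to w}`, with
`y` the noema `x + 11`. -/
def Term.miscoded (x : ℕ) : Term :=
  .abs (x + 11) (.allNat (x + 3) (.imp (.indexed x (.v (x + 11)) (.v (x + 3)))
    (.neg (.graph x (.v (x + 3)) (.v x)))))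

/-- A formula that holds nowhere. -/
def Formula.absurd : Formula := .nor (.mem .T .T) (.neg (.mem .T .T))

theorem IsSemantics.notMem_absurd (hS : IsSemantics S) : Formula.absurd ∉ S γ := by
  simp [Formula.absurd, hS.nor, hS.neg]

/-- `∀ v x ((A ∨ v x ∉ nat) ∨ v n ∈ miscoded)`, written so that the noema `v n` comes last. -/
def Formula.diagonal (x : ℕ) (A : Formula) (n : ℕ) : Formula :=
  .all x (.nor .absurd (.nor (.or A (.neg (.mem (.v x) .nat)))
    (.mem (.v n) (.miscoded x))))

/-- The code of `Formula.diagonal x A n` without the last noema. -/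
def diagonalPrefix (x : ℕ) (A : Formula) : ℕ :=
  cat (2 ^ 1) (cat (2 ^ (x + 5)) (cat (2 ^ 2) (cat Formula.absurd.code (cat (2 ^ 2)
    (cat (Formula.or A (.neg (.mem (.v x) .nat))).code (Term.miscoded x).code)))))

/-- The atomic formula `a ∈ b` is the string `ba`, and the outer `↓` with `Formula.absurd` expresses
disjunction without repeating its parts as `Formula.or` does. So `v n` stands once, at the very end,
and the prefix does not depend on `n`. -/
theorem code_diagonal (x : ℕ) (A : Formula) :
    (Formula.diagonal x A (diagonalPrefix x A)).code =
      (2 * diagonalPrefix x A + 1) * 2 ^ (diagonalPrefix x A + 5) := by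
  have : ∀ n, (Formula.diagonal x A n).code = cat (diagonalPrefix x A) (2 ^ (n + 5)) := by
    intro n
    simp only [Formula.diagonal, diagonalPrefix, cat_assoc, Formula.code, Formula.mem, Term.code]
  rw [this, cat, Nat.size_pow]
  ring

/-- The auxiliary noemata have indices up to `x + 13`, so the final noema differs from all of them.
-/
theorem lt_diagonalPrefix (x : ℕ) (A : Formula) : x + 13 < diagonalPrefix x A := by
  refine lt_of_lt_of_le ?_ ((le_cat_left _ _).trans (le_cat_right _ _))
  have := Nat.lt_two_pow_self (n := x)
  rw [pow_add]
  omega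

-- Noemata and substitution in the graph formula, and the diagonal equivalence

theorem nun_closure (x : ℕ) (a : Term) :
    (Formula.closure x a).nun ⊆ {x + 2, x + 8, x + 9, x + 10} ∪ a.nun := by
  intro n
  simp [Formula.closure, nun_allNat, nun_triple, Term.suc, Term.nun, nun_leib]
  grind

theorem nun_graph (x : ℕ) (a b : Term) :
    (Formula.graph x a b).nun ⊆ {x + 8, x + 9, x + 10} ∪ a.nun ∪ b.nun := by
  intro n hn
  simp only [Formula.graph, Formula.nun, nun_imp, nun_mem, Finset.mem_sdiff, Finset.mem_union,
    Finset.mem_singleton] at hn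
  obtain ⟨hn | hn, hx⟩ := hn
  · have := nun_closure x a hn
    simp at this ⊢
    tauto
  · simp [nun_triple, Term.suc, Term.nun, nun_leib] at hn ⊢
    tauto

theorem subst_closure (d : Term) {u x : ℕ} (hu : u = x ∨ u = x + 3) (a : Term) :
    Formula.subst d u (.closure x a) = .closure x (Term.subst d u a) := by
  have h (k : ℕ) (hk : 4 ≤ k ∨ k = 2) : u ≠ x + k := by omega
  have hv (k : ℕ) (hk : 4 ≤ k ∨ k = 2) := subst_v_ne d u (h k hk)
  have hs (k : ℕ) (hk : 4 ≤ k ∨ k = 2) :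
      Term.subst d u (Term.v (x + k)).suc = (Term.v (x + k)).suc :=
    Term.subst_of_notMem _ _ _ (by simp [Term.suc, Term.nun, nun_leib]; omega)
  have hss : Term.subst d u (Term.v (x + 5)).suc.suc = (Term.v (x + 5)).suc.suc :=
    Term.subst_of_notMem _ _ _ (by simp [Term.suc, Term.nun, nun_leib]; omega)
  simp [Formula.closure, subst_allNat, h, subst_triple _ (show u < x + 7 by omega), hv, hs, hss]

theorem subst_graph_left (d : Term) (x : ℕ) (b : Term) (hb : x + 3 ∉ b.nun) :
    Formula.subst d (x + 3) (.graph x (.v (x + 3)) b) = .graph x d b := by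
  simp [Formula.graph, subst_all, subst_closure, subst_triple, subst_suc, subst_v_ne,
    Term.subst_of_notMem _ _ _ hb]

theorem subst_graph_right (d : Term) (x : ℕ) :
    Formula.subst d x (.graph x (.v (x + 3)) (.v x)) = .graph x (.v (x + 3)) d := by
  have : Term.subst d x (Term.v (x + 3)).suc.suc.suc.suc.suc =
      (Term.v (x + 3)).suc.suc.suc.suc.suc :=
    Term.subst_of_notMem _ _ _ (by simp [Term.suc, Term.nun, nun_leib]; tauto)
  simp [Formula.graph, subst_all, subst_closure, subst_triple, subst_v_ne, this]

/-- The enumerator pairs `v n` with `n` alone, so the quantifier over `w` reduces to the case `w =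
n`. -/
theorem Arithmetical.mem_miscoded (hS : IsSemantics S) {θ : Ordinal.{0}} (h : Arithmetical S θ)
    (hγ : Order.succ θ < γ) {x n : ℕ} (hn : x + 13 < n) (m : ℕ) :
    Formula.mem (.v n) (Term.subst (.numeral m) x (.miscoded x)) ∈ S γ ↔
      m ≠ (2 * n + 1) * 2 ^ (n + 5) := by
  have hsub : Term.subst (.numeral m) x (.miscoded x) = .abs (x + 11) (.allNat (x + 3)
      (.imp (.indexed x (.v (x + 11)) (.v (x + 3)))
        (.neg (.graph x (.v (x + 3)) (.numeral m))))) := by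
    simp [Term.miscoded, subst_abs, subst_allNat, subst_graph_right, Formula.indexed, subst_ex,
      subst_v_ne]
  have hg : x + 11 ∉ (Formula.graph x (.v (x + 3)) (.numeral m)).nun := by
    refine Finset.notMem_mono (nun_graph _ _ _) ?_
    simp [Term.nun]
  rw [hsub, hS.mem_abs_of_settled (P := m ≠ (2 * n + 1) * 2 ^ (n + 5)) _ hγ, and_iff_right_of_imp]
  · intro _
    simp only [freeFor_allNat, freeFor_imp, freeFor_neg, Formula.freeFor_of_notMem _ _ _ hg,
      Formula.indexed, freeFor_ex, Term.nun, freeFor_and, freeFor_mem, freeFor_v, freeFor_E,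
      Finset.mem_singleton, and_true]
    exact Or.inr ⟨by omega, Or.inr ⟨by omega, Or.inr (by omega)⟩⟩
  · intro _ δ hδ
    have hδ := Order.succ_le_iff.1 hδ
    rw [subst_allNat _ (by omega), h.allNat_iff hS hδ.le]
    have key (k : ℕ) : Formula.subst (.numeral k) (x + 3) (Formula.subst (.v n) (x + 11)
        (.imp (.indexed x (.v (x + 11)) (.v (x + 3))) (.neg (.graph x (.v (x + 3)) (.numeral m))))) =
        .imp (.indexed x (.v n) (.numeral k)) (.neg (.graph x (.numeral k) (.numeral m))) := by
      simp [Formula.subst_of_notMem _ _ _ hg, subst_graph_left, Formula.indexed, subst_ex,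
        subst_v_ne _ _ (show x + 3 ≠ n by omega), subst_v_ne]
    simp only [key, hS.imp, h.indexed_iff hS hδ hn, hS.neg, h.graph_iff hS hδ]
    exact ⟨fun k => k n rfl, fun k l hl => hl ▸ k⟩

theorem Arithmetical.diagonal_iff (hS : IsSemantics S) {θ : Ordinal.{0}} (h : Arithmetical S θ)
    (hγ : Order.succ θ < γ) {x n : ℕ} (hn : x + 13 < n) (A : Formula) :
    Formula.diagonal x A n ∈ S γ ↔
      Formula.subst (.numeral ((2 * n + 1) * 2 ^ (n + 5))) x A ∈ S γ := by
  have hγ' : θ ≤ γ := (Order.le_succ θ).trans hγ.le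
  have hsub (a : Term) : Formula.subst a x (.nor .absurd (.nor
      (.or A (.neg (.mem (.v x) .nat))) (.mem (.v n) (.miscoded x)))) ∈ S γ ↔
      (Formula.subst a x A ∈ S γ ∨ Formula.mem a .nat ∉ S γ) ∨
        Formula.mem (.v n) (Term.subst a x (.miscoded x)) ∈ S γ := by
    have : Formula.subst a x .absurd = .absurd := by simp [Formula.absurd]
    simp [this, subst_v_ne _ _ (show x ≠ n by omega), hS.nor, hS.or, hS.neg, hS.notMem_absurd]
    tauto
  rw [Formula.diagonal, h.all_iff hS hγ' _ _ fun a ha => (hsub a).2 (Or.inl (Or.inr ha))]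
  simp only [hsub, h.mem_miscoded hS hγ hn]
  refine ⟨fun k => ?_, fun k m => ?_⟩
  -- At the computed number, membership in `Term.miscoded` fails and being a number holds, so only
  -- `A` remains.
  · refine ((k _).resolve_right (not_not.2 rfl)).resolve_right (not_not.2 ?_)
    exact (h.mem_nat γ hγ' _).2 ⟨_, .refl _⟩
  · by_cases hm : m = (2 * n + 1) * 2 ^ (n + 5)
    · exact Or.inl (Or.inl (hm ▸ k))
    · exact Or.inr hm

end Libra

theorem mainTheorem5 (S : Ordinal.{0} → Set Libra.Formula) (hS : Libra.IsSemantics S)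
    (x : ℕ) (A : Libra.Formula) (hA : A.nun = {x}) :
    ∃ B : Libra.Formula,
      Libra.Maxim S (Libra.Formula.iff B (Libra.Formula.subst B.quote x A)) := by
  obtain ⟨θ, h⟩ := Libra.exists_arithmetical hS
  -- With the number of the prefix as index of the last noema, the number computed in `diagonal_iff`
  -- is that of the formula itself.
  refine ⟨Libra.Formula.diagonal x A (Libra.diagonalPrefix x A),
    Libra.maxim_of_eventually hS ⟨Order.succ (Order.succ θ), fun γ hγ => ?_⟩⟩
  rw [hS.iff, h.diagonal_iff hS (Order.succ_le_iff.1 hγ) (Libra.lt_diagonalPrefix x A),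
    Libra.Formula.quote, Libra.code_diagonal]
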